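/- Let $k$ be an algebraically closed field of characteristic $p>0$ and let $A$ be a finite-dimensional commutative local $k$-algebra with maximal ideal $\mathfrak m$. Let $H_A=T(\mathfrak m^*)$ be the tensor algebra of the dual space $\mathfrak m^*$, made into a cocommutative Hopf algebra by the algebra maps $\varepsilon$ and $\Delta$ with $$\varepsilon(\varphi)=0,\qquad \Delta(\varphi)=\varphi\otimes 1+1\otimes\varphi+\Delta_0(\varphi)\qquad(\varphi\in\mathfrak m^*),$$ where $\Delta_0:\mathfrak m^*\to\mathfrak m^*\otimes\mathfrak m^*$ is the transpose of the multiplication $\mathfrak m\otimes\mathfrak m\to\mathfrak m$. Let $h=\min\{i\in\mathbf N : a^{p^i}=0\text{ for all }a\in\mathfrak m\}$. Let $\mathcal Z=k\{Z_1,Z_2,\ldots\}$ be the free associative algebra, a Hopf algebra with $\Delta Z_n=\sum_{i+j=n}Z_i\otimes Z_j$ (where $Z_0=1$) and $\varepsilon(Z_n)=0$ for $n\ge1$, graded by $\deg Z_n=n$. Let $(E_i)_{1\le i\le L}$, $1\le L\le\infty$, be a sequence in $\mathcal Z$ such that, with $E_0=1$ and for all indices $\le L$: * $\Delta E_n=\sum_{i+j=n}E_i\otimes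 E_j$; * $k\{E_1,\ldots,E_i\}=k\{E_1,\ldots,E_{p^r}\}$, where $p^r$ is the largest power of $p$ with $p^r\le i$; * $E_i$ is homogeneous of degree $i$; * $E_{p^i}-Z_{p^i}$ lies in the subalgebra generated by the $Z_j$ with $1\le j<p^i$. Let $\mathcal{NW}_1=k\{E_1\}$ be the Hopf subalgebra of $\mathcal Z$ generated by $E_1$ (the non-commutative Witt Hopf algebra of length $1$). If $h=1$, then: 1. $H_A$ is a coproduct, in the category of Hopf algebras over $k$, of $\dim_k\mathfrak m$ copies of $\mathcal{NW}_1$; 2. $\mathcal{NW}_1$ is the polynomial algebra $k[E_1]$, with $E_1$ primitive; 3. $H_A$ is isomorphic, as a Hopf algebra, to the universal enveloping algebra of the free Lie algebra over $k$ on $\dim_k\mathfrak m$ generators. -/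

import Mathlib

open scoped TensorProduct
open Coalgebra Bialgebra

/-- A bialgebra with an algebra map `S : H → Hᵐᵒᵖ` satisfying the antipode identities on a set of
algebra generators is a Hopf algebra with antipode `S`. -/
theorem antipode_right_of_generators {k H : Type*} [CommRing k] [Ring H] [Bialgebra k H]
    (S : H →ₐ[k] Hᵐᵒᵖ) (s : Set H) (hs : Algebra.adjoin k s = ⊤)
    (h : ∀ x ∈ s, LinearMap.mul' k H
      ((((MulOpposite.opLinearEquiv k).symm.toLinearMap ∘ₗ S.toLinearMap).rTensor H) (comul x)) =
        algebraMap k H (counit x)) :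
    LinearMap.mul' k H ∘ₗ
      ((MulOpposite.opLinearEquiv k).symm.toLinearMap ∘ₗ S.toLinearMap).rTensor H ∘ₗ comul =
      Algebra.linearMap k H ∘ₗ counit := by
  have key1 : ∀ (u : H ⊗[k] H) (b c : H), LinearMap.mul' k H
      ((((MulOpposite.opLinearEquiv k).symm.toLinearMap ∘ₗ S.toLinearMap).rTensor H)
        (u * b ⊗ₜ c)) = (S b).unop * LinearMap.mul' k H
      ((((MulOpposite.opLinearEquiv k).symm.toLinearMap ∘ₗ S.toLinearMap).rTensor H) u) * c := by
    intro u b c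
    induction u with
    | zero => simp
    | add x y hx hy => simp only [add_mul, map_add, mul_add, hx, hy]
    | tmul x y => simp [mul_assoc]
  have key2 : ∀ (u v : H ⊗[k] H) (r : k), LinearMap.mul' k H
      ((((MulOpposite.opLinearEquiv k).symm.toLinearMap ∘ₗ S.toLinearMap).rTensor H) u) =
        algebraMap k H r → LinearMap.mul' k H
      ((((MulOpposite.opLinearEquiv k).symm.toLinearMap ∘ₗ S.toLinearMap).rTensor H) (u * v)) =
       algebraMap k H r * LinearMap.mul' k H
      ((((MulOpposite.opLinearEquiv k).symm.toLinearMap ∘ₗ S.toLinearMap).rTensor H) v) := by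
    intro u v r hu
    induction v with
    | zero => simp
    | add x y hx hy => simp only [map_add, mul_add, hx, hy]
    | tmul x y =>
      rw [key1, hu, ← Algebra.commutes, mul_assoc]
      simp
  ext x
  have hx : x ∈ Algebra.adjoin k s := hs ▸ Algebra.mem_top
  simp only [LinearMap.comp_apply, Algebra.linearMap_apply]
  induction hx using Algebra.adjoin_induction with
  | mem x hx => exact h x hx
  | algebraMap r => simp [Algebra.TensorProduct.algebraMap_apply]
  | add x y _ _ hx hy => simp only [map_add, hx, hy]
  | mul x y _ _ hx hy => rw [comul_mul, key2 _ _ _ hx, hy, counit_mul, map_mul]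

theorem antipode_left_of_generators {k H : Type*} [CommRing k] [Ring H] [Bialgebra k H]
    (S : H →ₐ[k] Hᵐᵒᵖ) (s : Set H) (hs : Algebra.adjoin k s = ⊤)
    (h : ∀ x ∈ s, LinearMap.mul' k H
      ((((MulOpposite.opLinearEquiv k).symm.toLinearMap ∘ₗ S.toLinearMap).lTensor H) (comul x)) =
        algebraMap k H (counit x)) :
    LinearMap.mul' k H ∘ₗ
      ((MulOpposite.opLinearEquiv k).symm.toLinearMap ∘ₗ S.toLinearMap).lTensor H ∘ₗ comul =
      Algebra.linearMap k H ∘ₗ counit := by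
  have key1 : ∀ (u : H ⊗[k] H) (b c : H), LinearMap.mul' k H
      ((((MulOpposite.opLinearEquiv k).symm.toLinearMap ∘ₗ S.toLinearMap).lTensor H)
        (b ⊗ₜ c * u)) = b * LinearMap.mul' k H
      ((((MulOpposite.opLinearEquiv k).symm.toLinearMap ∘ₗ S.toLinearMap).lTensor H) u) *
        (S c).unop := by
    intro u b c
    induction u with
    | zero => simp
    | add x y hx hy => simp only [add_mul, map_add, mul_add, hx, hy]
    | tmul x y => simp [mul_assoc]
  have key2 : ∀ (u v : H ⊗[k] H) (r : k), LinearMap.mul' k H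
      ((((MulOpposite.opLinearEquiv k).symm.toLinearMap ∘ₗ S.toLinearMap).lTensor H) u) =
        algebraMap k H r → LinearMap.mul' k H
      ((((MulOpposite.opLinearEquiv k).symm.toLinearMap ∘ₗ S.toLinearMap).lTensor H) (v * u)) =
       algebraMap k H r * LinearMap.mul' k H
      ((((MulOpposite.opLinearEquiv k).symm.toLinearMap ∘ₗ S.toLinearMap).lTensor H) v) := by
    intro u v r hu
    induction v with
    | zero => simp
    | add x y hx hy => simp only [map_add, mul_add, add_mul, hx, hy]
    | tmul x y =>
      rw [key1, hu, ← Algebra.commutes, mul_assoc]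
      simp
  ext x
  have hx : x ∈ Algebra.adjoin k s := hs ▸ Algebra.mem_top
  simp only [LinearMap.comp_apply, Algebra.linearMap_apply]
  induction hx using Algebra.adjoin_induction with
  | mem x hx => exact h x hx
  | algebraMap r => simp [Algebra.TensorProduct.algebraMap_apply]
  | add x y _ _ hx hy => simp only [map_add, hx, hy]
  | mul x y _ _ hx hy =>
    rw [comul_mul, key2 _ _ _ hy, hx, counit_mul, map_mul, Algebra.commutes]

/-- A bialgebra with an anti-multiplicative map satisfying the antipode identities on algebra
generators is a Hopf algebra. -/
noncomputable abbrev HopfAlgebra.ofGenerators {k H : Type*} [CommRing k] [Ring H] [Bialgebra k H]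
    (S : H →ₐ[k] Hᵐᵒᵖ) (s : Set H) (hs : Algebra.adjoin k s = ⊤)
    (hr : ∀ x ∈ s, LinearMap.mul' k H
      ((((MulOpposite.opLinearEquiv k).symm.toLinearMap ∘ₗ S.toLinearMap).rTensor H) (comul x)) =
        algebraMap k H (counit x))
    (hl : ∀ x ∈ s, LinearMap.mul' k H
      ((((MulOpposite.opLinearEquiv k).symm.toLinearMap ∘ₗ S.toLinearMap).lTensor H) (comul x)) =
        algebraMap k H (counit x)) : HopfAlgebra k H where
  antipode := (MulOpposite.opLinearEquiv k).symm.toLinearMap ∘ₗ S.toLinearMap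
  mul_antipode_rTensor_comul := antipode_right_of_generators S s hs hr
  mul_antipode_lTensor_comul := antipode_left_of_generators S s hs hl

/-! ### Universal enveloping algebras -/

section
attribute [local instance 100] LieRing.ofAssociativeRing

/-- The sum of two Lie algebra maps into an associative algebra with commuting images. -/
def LieHom.addOfCommute {R L B : Type*} [CommRing R] [LieRing L] [LieAlgebra R L]
    [Ring B] [Algebra R B] (f g : L →ₗ⁅R⁆ B) (h : ∀ x y, Commute (f x) (g y)) : L →ₗ⁅R⁆ B where
  toLinearMap := (f : L →ₗ[R] B) + (g : L →ₗ[R] B)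
  map_lie' := by
    intro x y
    have h1 := (h x y).eq
    have h2 := (h y x).eq
    simp only [LieRing.of_associative_ring_bracket, AddHom.toFun_eq_coe, LinearMap.coe_toAddHom,
      LinearMap.add_apply, LieHom.coe_toLinearMap, LieHom.map_lie, mul_add, add_mul, h1, h2]
    abel

/-- The negative of a Lie algebra map into an associative algebra, as a Lie algebra map into the
opposite algebra. -/
def LieHom.opNeg {R L B : Type*} [CommRing R] [LieRing L] [LieAlgebra R L]
    [Ring B] [Algebra R B] (f : L →ₗ⁅R⁆ B) : L →ₗ⁅R⁆ Bᵐᵒᵖ where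
  toLinearMap := -((MulOpposite.opLinearEquiv R).toLinearMap ∘ₗ (f : L →ₗ[R] B))
  map_lie' := by
    intro x y
    apply MulOpposite.unop_injective
    simp [LieRing.of_associative_ring_bracket]

theorem LieHom.opNeg_apply {R L B : Type*} [CommRing R] [LieRing L] [LieAlgebra R L]
    [Ring B] [Algebra R B] (f : L →ₗ⁅R⁆ B) (x : L) : f.opNeg x = MulOpposite.op (-f x) := rfl

namespace UniversalEnvelopingAlgebra

variable (R L : Type*) [CommRing R] [LieRing L] [LieAlgebra R L]

/-- The comultiplication of `U(L)`: the algebra map with `x ↦ x ⊗ 1 + 1 ⊗ x` for `x ∈ L`. -/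
noncomputable def comulHom : UniversalEnvelopingAlgebra R L →ₐ[R]
    UniversalEnvelopingAlgebra R L ⊗[R] UniversalEnvelopingAlgebra R L :=
  lift R (LieHom.addOfCommute
    ((Algebra.TensorProduct.includeLeft : UniversalEnvelopingAlgebra R L →ₐ[R]
      UniversalEnvelopingAlgebra R L ⊗[R] UniversalEnvelopingAlgebra R L).toLieHom.comp (ι R))
    ((Algebra.TensorProduct.includeRight : UniversalEnvelopingAlgebra R L →ₐ[R]
      UniversalEnvelopingAlgebra R L ⊗[R] UniversalEnvelopingAlgebra R L).toLieHom.comp (ι R))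
    (fun x y => by simp [commute_iff_eq]))

/-- The counit of `U(L)`: the algebra map with `x ↦ 0` for `x ∈ L`. -/
noncomputable def counitHom : UniversalEnvelopingAlgebra R L →ₐ[R] R := lift R 0

theorem algHom_ext' {B : Type*} [Ring B] [Algebra R B]
    {f g : UniversalEnvelopingAlgebra R L →ₐ[R] B} (h : ∀ x, f (ι R x) = g (ι R x)) : f = g :=
  hom_ext R (LieHom.ext h)

theorem comulHom_ι (x : L) : comulHom R L (ι R x) = ι R x ⊗ₜ 1 + 1 ⊗ₜ ι R x := by
  rw [comulHom, lift_ι_apply]; rfl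

theorem counitHom_ι (x : L) : counitHom R L (ι R x) = 0 := by
  rw [counitHom, lift_ι_apply]; rfl

theorem adjoin_range_ι : Algebra.adjoin R (Set.range (ι R : L → _)) =
    (⊤ : Subalgebra R (UniversalEnvelopingAlgebra R L)) := by
  let S := Algebra.adjoin R (Set.range (ι R : L → UniversalEnvelopingAlgebra R L))
  let f : L →ₗ⁅R⁆ S :=
    { toFun := fun x => ⟨ι R x, Algebra.subset_adjoin ⟨x, rfl⟩⟩
      map_add' := fun x y => Subtype.ext (by simp)
      map_smul' := fun r x => Subtype.ext (by simp)
      map_lie' := fun {x y} => Subtype.ext (by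
        simp [LieRing.of_associative_ring_bracket]) }
  have h : S.val.comp (lift R f) = AlgHom.id R _ := algHom_ext' R L fun x => by
    simp only [AlgHom.comp_apply, lift_ι_apply]; rfl
  refine eq_top_iff.2 fun x _ => ?_
  rw [← AlgHom.id_apply (R := R) x, ← h]
  exact (lift R f x).2

noncomputable instance instBialgebra : Bialgebra R (UniversalEnvelopingAlgebra R L) :=
  .ofAlgHom (comulHom R L) (counitHom R L)
    (algHom_ext' R L fun x => by
      simp [comulHom_ι, Algebra.TensorProduct.one_def, TensorProduct.add_tmul,
        TensorProduct.tmul_add, -ι_apply]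
      abel)
    (algHom_ext' R L fun x => by simp [comulHom_ι, counitHom_ι, -ι_apply])
    (algHom_ext' R L fun x => by simp [comulHom_ι, counitHom_ι, -ι_apply])

/-- The antipode of `U(L)` is the anti-automorphism with `x ↦ -x` for `x ∈ L`. -/
noncomputable instance instHopfAlgebra : HopfAlgebra R (UniversalEnvelopingAlgebra R L) :=
  .ofGenerators (lift R (LieHom.opNeg (ι R))) (Set.range (ι R)) (adjoin_range_ι R L)
    (by
      rintro _ ⟨x, rfl⟩
      change LinearMap.mul' R _ (LinearMap.rTensor _ _ (comulHom R L (ι R x))) =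
        algebraMap R _ (counitHom R L (ι R x))
      rw [comulHom_ι, counitHom_ι, map_zero]
      simp only [map_add, LinearMap.rTensor_tmul, LinearMap.comp_apply, AlgHom.toLinearMap_apply,
        lift_ι_apply, map_one, LinearMap.mul'_apply]
      simp [LieHom.opNeg_apply, -ι_apply])
    (by
      rintro _ ⟨x, rfl⟩
      change LinearMap.mul' R _ (LinearMap.lTensor _ _ (comulHom R L (ι R x))) =
        algebraMap R _ (counitHom R L (ι R x))
      rw [comulHom_ι, counitHom_ι, map_zero]
      simp only [map_add, LinearMap.lTensor_tmul, LinearMap.comp_apply, AlgHom.toLinearMap_apply,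
        lift_ι_apply, map_one, LinearMap.mul'_apply]
      simp [LieHom.opNeg_apply, -ι_apply])

end UniversalEnvelopingAlgebra
end

/-! ### Hopf subalgebras -/

section SubHopf

variable {k H : Type*} [Field k] [Ring H] [HopfAlgebra k H]

/-- A subalgebra `B` of a Hopf algebra `H` is a Hopf subalgebra if `Δ(B)` lies in the image of
`B ⊗ B` and `S(B) ⊆ B`. -/
structure Subalgebra.IsHopf (B : Subalgebra k H) : Prop where
  comul_mem : ∀ x ∈ B, (comul x : H ⊗[k] H) ∈ (Algebra.TensorProduct.map B.val B.val).range
  antipode_mem : ∀ x ∈ B, HopfAlgebra.antipode k x ∈ B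

variable (B : Subalgebra k H)

theorem Subalgebra.val_injective' : Function.Injective B.val.toLinearMap := Subtype.val_injective

theorem Subalgebra.map_val_injective :
    Function.Injective (Algebra.TensorProduct.map B.val B.val) :=
  TensorProduct.map_injective_of_flat_flat B.val.toLinearMap B.val.toLinearMap
    B.val_injective' B.val_injective'

variable {B}

/-- The comultiplication of `H` restricted to a Hopf subalgebra. -/
noncomputable def Subalgebra.IsHopf.comulHom (hB : B.IsHopf) : B →ₐ[k] B ⊗[k] B :=
  (AlgEquiv.ofInjective _ B.map_val_injective).symm.toAlgHom.comp
    (((comulAlgHom k H).comp B.val).codRestrict _ fun x => hB.comul_mem x x.2)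

theorem Subalgebra.IsHopf.map_comulHom (hB : B.IsHopf) (x : B) :
    Algebra.TensorProduct.map B.val B.val (hB.comulHom x) = comul (x : H) := by
  have := (AlgEquiv.ofInjective _ B.map_val_injective).apply_symm_apply
    ((((comulAlgHom k H).comp B.val).codRestrict _ fun x => hB.comul_mem x x.2) x)
  exact congrArg Subtype.val this

theorem Subalgebra.IsHopf.map_comp_comulHom (hB : B.IsHopf) :
    (Algebra.TensorProduct.map B.val B.val).comp hB.comulHom = (comulAlgHom k H).comp B.val :=
  AlgHom.ext hB.map_comulHom

/-- A Hopf subalgebra as a bialgebra, with the restricted operations. -/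
@[reducible] noncomputable def Subalgebra.IsHopf.bialgebra (hB : B.IsHopf) : Bialgebra k B :=
  .ofAlgHom hB.comulHom ((counitAlgHom k H).comp B.val)
    (by
      have hinj : Function.Injective (Algebra.TensorProduct.map B.val
          (Algebra.TensorProduct.map B.val B.val)) :=
        TensorProduct.map_injective_of_flat_flat B.val.toLinearMap
          (Algebra.TensorProduct.map B.val B.val).toLinearMap
          B.val_injective' B.map_val_injective
      ext x
      apply hinj
      have hl : ∀ u : B ⊗[k] B, Algebra.TensorProduct.map B.val
          (Algebra.TensorProduct.map B.val B.val) (Algebra.TensorProduct.assoc k k k B B B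
            (Algebra.TensorProduct.map hB.comulHom (AlgHom.id k B) u)) =
          Algebra.TensorProduct.assoc k k k H H H (Algebra.TensorProduct.map (comulAlgHom k H)
            (AlgHom.id k H) (Algebra.TensorProduct.map B.val B.val u)) := by
        intro u
        induction u with
        | zero => simp
        | add a b ha hb => simp only [map_add, ha, hb]
        | tmul a b =>
          simp only [Algebra.TensorProduct.map_tmul, AlgHom.id_apply, comulAlgHom_apply,
            Subalgebra.val_apply]
          rw [← hB.map_comulHom a]
          induction hB.comulHom a with
          | zero => simp
          | add c d hc hd => simp only [map_add, TensorProduct.add_tmul, hc, hd]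
          | tmul c d => simp
      have hr : ∀ u : B ⊗[k] B, Algebra.TensorProduct.map B.val
          (Algebra.TensorProduct.map B.val B.val)
            (Algebra.TensorProduct.map (AlgHom.id k B) hB.comulHom u) =
          Algebra.TensorProduct.map (AlgHom.id k H) (comulAlgHom k H)
            (Algebra.TensorProduct.map B.val B.val u) := by
        intro u
        induction u with
        | zero => simp
        | add a b ha hb => simp only [map_add, ha, hb]
        | tmul a b =>
          simp only [Algebra.TensorProduct.map_tmul, AlgHom.id_apply, comulAlgHom_apply,
            Subalgebra.val_apply]
          rw [hB.map_comulHom b]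
      refine (hl _).trans (Eq.trans ?_ (hr _).symm)
      erw [hB.map_comulHom x]
      exact Coalgebra.coassoc_apply (R := k) (x : H))
    (by
      ext x
      apply (Algebra.TensorProduct.lid k B).injective
      apply Subtype.val_injective
      have h : ∀ u : B ⊗[k] B, ((Algebra.TensorProduct.lid k B
          (Algebra.TensorProduct.map ((counitAlgHom k H).comp B.val) (AlgHom.id k B) u) : B) : H) =
          Algebra.TensorProduct.lid k H (Algebra.TensorProduct.map (counitAlgHom k H)
            (AlgHom.id k H) (Algebra.TensorProduct.map B.val B.val u)) := by
        intro u
        induction u with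
        | zero => simp
        | add a b ha hb => simp only [map_add, AddMemClass.coe_add, ha, hb]
        | tmul a b => simp
      refine (h _).trans ?_
      erw [hB.map_comulHom x]
      have := Coalgebra.rTensor_counit_comul (R := k) (x : H)
      change Algebra.TensorProduct.lid k H (LinearMap.rTensor H counit (comul (x : H))) = _
      rw [this]; simp)
    (by
      ext x
      apply (Algebra.TensorProduct.rid k k B).injective
      apply Subtype.val_injective
      have h : ∀ u : B ⊗[k] B, ((Algebra.TensorProduct.rid k k B
          (Algebra.TensorProduct.map (AlgHom.id k B) ((counitAlgHom k H).comp B.val) u) : B) : H) =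
          Algebra.TensorProduct.rid k k H (Algebra.TensorProduct.map (AlgHom.id k H)
            (counitAlgHom k H) (Algebra.TensorProduct.map B.val B.val u)) := by
        intro u
        induction u with
        | zero => simp
        | add a b ha hb => simp only [map_add, AddMemClass.coe_add, ha, hb]
        | tmul a b => simp
      refine (h _).trans ?_
      erw [hB.map_comulHom x]
      have := Coalgebra.lTensor_counit_comul (R := k) (x : H)
      change Algebra.TensorProduct.rid k k H (LinearMap.lTensor H counit (comul (x : H))) = _
      rw [this]; simp)

/-- A Hopf subalgebra as a Hopf algebra, with the restricted operations. -/
@[reducible] noncomputable def Subalgebra.IsHopf.hopfAlgebra (hB : B.IsHopf) : HopfAlgebra k B :=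
  letI := hB.bialgebra
  { antipode := (HopfAlgebra.antipode k ∘ₗ B.val.toLinearMap).codRestrict B.toSubmodule
      fun x => hB.antipode_mem x x.2
    mul_antipode_rTensor_comul := by
      ext x
      have h : ∀ u : B ⊗[k] B, ((LinearMap.mul' k B (LinearMap.rTensor B
          ((HopfAlgebra.antipode k ∘ₗ B.val.toLinearMap).codRestrict B.toSubmodule
            fun x => hB.antipode_mem x x.2) u) : B) : H) =
          LinearMap.mul' k H (LinearMap.rTensor H (HopfAlgebra.antipode k)
            (Algebra.TensorProduct.map B.val B.val u)) := by
        intro u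
        induction u with
        | zero => simp
        | add a b ha hb => simp only [map_add, AddMemClass.coe_add, ha, hb]
        | tmul a b => rfl
      refine (h _).trans ?_
      change LinearMap.mul' k H (LinearMap.rTensor H (HopfAlgebra.antipode k)
        (Algebra.TensorProduct.map B.val B.val (hB.comulHom x))) = _
      rw [hB.map_comulHom x, HopfAlgebra.mul_antipode_rTensor_comul_apply]
      rfl
    mul_antipode_lTensor_comul := by
      ext x
      have h : ∀ u : B ⊗[k] B, ((LinearMap.mul' k B (LinearMap.lTensor B
          ((HopfAlgebra.antipode k ∘ₗ B.val.toLinearMap).codRestrict B.toSubmodule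
            fun x => hB.antipode_mem x x.2) u) : B) : H) =
          LinearMap.mul' k H (LinearMap.lTensor H (HopfAlgebra.antipode k)
            (Algebra.TensorProduct.map B.val B.val u)) := by
        intro u
        induction u with
        | zero => simp
        | add a b ha hb => simp only [map_add, AddMemClass.coe_add, ha, hb]
        | tmul a b => rfl
      refine (h _).trans ?_
      change LinearMap.mul' k H (LinearMap.lTensor H (HopfAlgebra.antipode k)
        (Algebra.TensorProduct.map B.val B.val (hB.comulHom x))) = _
      rw [hB.map_comulHom x, HopfAlgebra.mul_antipode_lTensor_comul_apply]
      rfl }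

end SubHopf

/-! ### The Hopf algebra of non-commutative symmetric functions -/

universe u

/-- The free associative algebra on variables `Z₁, Z₂, …`; the variable `Zₙ₊₁` is the generator
with index `n : ℕ`. -/
def NSymm (k : Type u) [CommRing k] : Type u := FreeAlgebra k ℕ

namespace NSymm

section Ring

variable (k : Type u) [CommRing k]

noncomputable instance : Ring (NSymm k) := inferInstanceAs (Ring (FreeAlgebra k ℕ))
noncomputable instance : Algebra k (NSymm k) := inferInstanceAs (Algebra k (FreeAlgebra k ℕ))

/-- The elements `Z₀ = 1, Z₁, Z₂, …`. -/
noncomputable def Z : ℕ → NSymm k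
  | 0 => 1
  | n + 1 => FreeAlgebra.ι k n

variable {k}

/-- The algebra map out of `NSymm k` with prescribed values on the variables. -/
noncomputable def lift {B : Type*} [Ring B] [Algebra k B] (f : ℕ → B) : NSymm k →ₐ[k] B :=
  FreeAlgebra.lift k fun n => f (n + 1)

theorem lift_Z_succ {B : Type*} [Ring B] [Algebra k B] (f : ℕ → B) (n : ℕ) :
    lift f (Z k (n + 1)) = f (n + 1) := FreeAlgebra.lift_ι_apply _ _

theorem lift_Z {B : Type*} [Ring B] [Algebra k B] (f : ℕ → B) (h : f 0 = 1) :
    ∀ n, lift f (Z k n) = f n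
  | 0 => by rw [h]; exact map_one _
  | n + 1 => lift_Z_succ f n

theorem algHom_ext {B : Type*} [Ring B] [Algebra k B] {f g : NSymm k →ₐ[k] B}
    (h : ∀ n, f (Z k n) = g (Z k n)) : f = g :=
  FreeAlgebra.hom_ext (funext fun n => h (n + 1))

variable (k)

theorem adjoin_range_Z : Algebra.adjoin k (Set.range (Z k)) = ⊤ := by
  refine top_le_iff.1 ((FreeAlgebra.adjoin_range_ι k ℕ).symm.le.trans (Algebra.adjoin_mono ?_))
  rintro _ ⟨n, rfl⟩
  exact ⟨n + 1, rfl⟩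

/-- The comultiplication, with `Zₙ ↦ ∑ Zᵢ ⊗ Zⱼ` over `i + j = n`. -/
noncomputable def comulHom : NSymm k →ₐ[k] NSymm k ⊗[k] NSymm k :=
  lift fun n => ∑ ij ∈ Finset.HasAntidiagonal.antidiagonal n, Z k ij.1 ⊗ₜ[k] Z k ij.2

/-- The counit, with `Zₙ ↦ 0` for `n ≥ 1`. -/
noncomputable def counitHom : NSymm k →ₐ[k] k := lift fun n => if n = 0 then 1 else 0

theorem comulHom_Z (n : ℕ) :
    comulHom k (Z k n) = ∑ ij ∈ Finset.HasAntidiagonal.antidiagonal n, Z k ij.1 ⊗ₜ[k] Z k ij.2 :=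
  lift_Z _ (by simp [Z, Algebra.TensorProduct.one_def]) n

theorem counitHom_Z (n : ℕ) : counitHom k (Z k n) = if n = 0 then 1 else 0 :=
  lift_Z _ (by simp) n

noncomputable instance instBialgebra : Bialgebra k (NSymm k) :=
  .ofAlgHom (comulHom k) (counitHom k)
    (algHom_ext fun n => by
      simp only [AlgHom.comp_apply, AlgEquiv.toAlgHom_apply, comulHom_Z, map_sum,
        Algebra.TensorProduct.map_tmul, AlgHom.id_apply, TensorProduct.sum_tmul,
        TensorProduct.tmul_sum, Algebra.TensorProduct.assoc_tmul]
      rw [Finset.sum_sigma', Finset.sum_sigma']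
      refine Finset.sum_nbij' (fun x => ⟨(x.2.1, x.2.2 + x.1.2), (x.2.2, x.1.2)⟩)
        (fun x => ⟨(x.1.1 + x.2.1, x.2.2), (x.1.1, x.2.1)⟩) ?_ ?_ ?_ ?_ ?_
      all_goals rintro ⟨⟨a, b⟩, ⟨c, d⟩⟩
      all_goals simp only [Finset.mem_sigma, Finset.HasAntidiagonal.mem_antidiagonal]
      · rintro ⟨rfl, rfl⟩; exact ⟨by omega, trivial⟩
      · rintro ⟨rfl, rfl⟩; exact ⟨by omega, trivial⟩
      · rintro ⟨rfl, rfl⟩; rfl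
      · rintro ⟨rfl, rfl⟩; rfl
      · intro _; trivial)
    (algHom_ext fun n => by
      simp only [AlgHom.comp_apply, comulHom_Z, map_sum, Algebra.TensorProduct.map_tmul,
        AlgHom.id_apply, counitHom_Z]
      rw [Finset.sum_eq_single (0, n)]
      · simp
      · rintro ⟨i, j⟩ hij hne
        have : i ≠ 0 := by
          rintro rfl; exact hne (by simpa using hij)
        simp [this]
      · simp)
    (algHom_ext fun n => by
      simp only [AlgHom.comp_apply, comulHom_Z, map_sum, Algebra.TensorProduct.map_tmul,
        AlgHom.id_apply, counitHom_Z]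
      rw [Finset.sum_eq_single (n, 0)]
      · simp
      · rintro ⟨i, j⟩ hij hne
        have : j ≠ 0 := by
          rintro rfl; exact hne (by simpa using hij)
        simp [this]
      · simp)

/-- The elements `S₀ = 1, S₁, S₂, …` with `∑ Sᵢ Zⱼ = 0` over `i + j = n`, for `n ≥ 1`. -/
noncomputable def S (n : ℕ) : NSymm k :=
  PowerSeries.coeff n (PowerSeries.invOfUnit (PowerSeries.mk (Z k)) 1)

theorem S_zero : S k 0 = 1 := by simp [S]

theorem sum_S_mul_Z (n : ℕ) :
    ∑ ij ∈ Finset.HasAntidiagonal.antidiagonal n, S k ij.1 * Z k ij.2 = if n = 0 then 1 else 0 := by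
  have h := congrArg (PowerSeries.coeff n) (PowerSeries.invOfUnit_mul (PowerSeries.mk (Z k)) 1
    (by simp [Z]))
  simpa [PowerSeries.coeff_mul, PowerSeries.coeff_one, S] using h

theorem sum_Z_mul_S (n : ℕ) :
    ∑ ij ∈ Finset.HasAntidiagonal.antidiagonal n, Z k ij.1 * S k ij.2 = if n = 0 then 1 else 0 := by
  have h := congrArg (PowerSeries.coeff n) (PowerSeries.mul_invOfUnit (PowerSeries.mk (Z k)) 1
    (by simp [Z]))
  simpa [PowerSeries.coeff_mul, PowerSeries.coeff_one, S] using h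

/-- The antipode is the anti-endomorphism with `Zₙ ↦ Sₙ`. -/
noncomputable instance instHopfAlgebra : HopfAlgebra k (NSymm k) :=
  .ofGenerators (lift fun n => MulOpposite.op (S k n)) (Set.range (Z k)) (adjoin_range_Z k)
    (by
      rintro _ ⟨n, rfl⟩
      change LinearMap.mul' k _ (LinearMap.rTensor _ _ (comulHom k (Z k n))) =
        algebraMap k _ (counitHom k (Z k n))
      rw [comulHom_Z, counitHom_Z]
      simp only [map_sum, LinearMap.rTensor_tmul, LinearMap.comp_apply, AlgHom.toLinearMap_apply,
        LinearMap.mul'_apply]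
      simp_rw [lift_Z (fun n => MulOpposite.op (S k n)) (by simp [S_zero])]
      refine (sum_S_mul_Z k n).trans ?_
      split_ifs <;> simp)
    (by
      rintro _ ⟨n, rfl⟩
      change LinearMap.mul' k _ (LinearMap.lTensor _ _ (comulHom k (Z k n))) =
        algebraMap k _ (counitHom k (Z k n))
      rw [comulHom_Z, counitHom_Z]
      simp only [map_sum, LinearMap.lTensor_tmul, LinearMap.comp_apply, AlgHom.toLinearMap_apply,
        LinearMap.mul'_apply]
      simp_rw [lift_Z (fun n => MulOpposite.op (S k n)) (by simp [S_zero])]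
      refine (sum_Z_mul_S k n).trans ?_
      split_ifs <;> simp)

/-- The homogeneous component of degree `n` for the grading in which `Zᵢ` has degree `i`: the span
of the products `Z_{i₁} ⋯ Z_{iᵣ}` with `i₁ + ⋯ + iᵣ = n`. -/
noncomputable def homogeneousComponent (n : ℕ) : Submodule k (NSymm k) :=
  Submodule.span k {x | ∃ l : List ℕ, l.sum = n ∧ x = (l.map (Z k)).prod}

end Ring

end NSymm

/-! ### Curves and non-commutative Witt Hopf algebras -/

/-- `(c₁, c₂, …, c_L)` is a curve of length `L ∈ ℕ ∪ {∞}` in `H`, where `c₀ = 1`. Values of `c`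
beyond `L` are irrelevant. -/
structure IsCurve (k : Type*) {H : Type*} [CommRing k] [Ring H] [HopfAlgebra k H] (L : ℕ∞)
    (c : ℕ → H) : Prop where
  zero : c 0 = 1
  comul : ∀ j : ℕ, 1 ≤ j → (j : ℕ∞) ≤ L →
    (comul (c j) : H ⊗[k] H) = ∑ ij ∈ Finset.HasAntidiagonal.antidiagonal j, c ij.1 ⊗ₜ[k] c ij.2

/-- A curve is minimal if `k{c₁, …, cᵢ} = k{c₁, …, c_{p^‖i‖}}` for all `i`, where `p^‖i‖` is the
largest power of `p` that is at most `i`. -/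
structure IsMinimalCurve (k : Type*) {H : Type*} [CommRing k] [Ring H] [HopfAlgebra k H] (p : ℕ)
    (L : ℕ∞) (c : ℕ → H) : Prop extends IsCurve k L c where
  minimal : ∀ i : ℕ, 1 ≤ i → (i : ℕ∞) ≤ L →
    Algebra.adjoin k (c '' Set.Icc 1 i) = Algebra.adjoin k (c '' Set.Icc 1 (p ^ Nat.log p i))

/-- A minimal curve in `NSymm k` that is homogeneous (`Eᵢ` has degree `i`) and such that
`E_{p^i} - Z_{p^i}` involves only variables `Zⱼ` with `j < p^i`. -/
structure IsHomogeneousMinimalCurve (k : Type u) [CommRing k] (p : ℕ) (L : ℕ∞) (E : ℕ → NSymm k) :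
    Prop extends IsMinimalCurve k p L E where
  homogeneous : ∀ i : ℕ, (i : ℕ∞) ≤ L → E i ∈ NSymm.homogeneousComponent k i
  leading : ∀ i : ℕ, ((p ^ i : ℕ) : ℕ∞) ≤ L →
    E (p ^ i) - NSymm.Z k (p ^ i) ∈ Algebra.adjoin k (NSymm.Z k '' Set.Ico 1 (p ^ i))

/-- The subalgebra `k{E_{p^0}, …, E_{p^ℓ}}` of `NSymm k`. -/
noncomputable def ncWittSubalgebra {k : Type u} [CommRing k] (p : ℕ) (E : ℕ → NSymm k) (ℓ : ℕ) :
    Subalgebra k (NSymm k) :=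
  Algebra.adjoin k {x | ∃ i ≤ ℓ, x = E (p ^ i)}

section NCWitt

variable {k : Type u} [Field k] {p : ℕ} [Fact p.Prime] {L : ℕ∞} {E : ℕ → NSymm k}

theorem IsMinimalCurve.mem_ncWittSubalgebra (hE : IsMinimalCurve k p L E) {ℓ : ℕ}
    (hℓ : ((p ^ ℓ : ℕ) : ℕ∞) ≤ L) (m : ℕ) (hm : m ≤ p ^ ℓ) : E m ∈ ncWittSubalgebra p E ℓ := by
  have hp : 1 < p := (Fact.out : p.Prime).one_lt
  induction m using Nat.strong_induction_on with
  | _ m ih =>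
    rcases Nat.eq_zero_or_pos m with rfl | hm0
    · rw [hE.zero]; exact one_mem _
    have hle : p ^ Nat.log p m ≤ m := Nat.pow_log_le_self p hm0.ne'
    rcases hle.eq_or_lt with h | h
    · refine Algebra.subset_adjoin ⟨Nat.log p m, ?_, by rw [h]⟩
      exact (Nat.pow_le_pow_iff_right hp).1 (hle.trans hm)
    · have h1 : E m ∈ Algebra.adjoin k (E '' Set.Icc 1 m) :=
        Algebra.subset_adjoin ⟨m, ⟨hm0, le_rfl⟩, rfl⟩
      rw [hE.minimal m hm0 (le_trans (by exact_mod_cast hm) hℓ)] at h1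
      refine Algebra.adjoin_le ?_ h1
      rintro _ ⟨j, ⟨_, hj⟩, rfl⟩
      exact ih j (hj.trans_lt h) ((hj.trans hle).trans hm)

theorem IsMinimalCurve.isHopf_ncWittSubalgebra (hE : IsMinimalCurve k p L E) {ℓ : ℕ}
    (hℓ : ((p ^ ℓ : ℕ) : ℕ∞) ≤ L) : (ncWittSubalgebra p E ℓ).IsHopf (k := k) := by
  have hp : 1 < p := (Fact.out : p.Prime).one_lt
  have hmem := hE.mem_ncWittSubalgebra hℓ
  have hcomul : ∀ m ≤ p ^ ℓ, (comul (E m) : NSymm k ⊗[k] NSymm k) =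
      ∑ ij ∈ Finset.HasAntidiagonal.antidiagonal m, E ij.1 ⊗ₜ[k] E ij.2 := by
    intro m hm
    rcases Nat.eq_zero_or_pos m with rfl | hm0
    · simp [hE.zero, Algebra.TensorProduct.one_def]
    · exact hE.comul m hm0 (le_trans (by exact_mod_cast hm) hℓ)
  have hanti : ∀ m ≤ p ^ ℓ, HopfAlgebra.antipode k (E m) ∈ ncWittSubalgebra p E ℓ := by
    intro m
    induction m using Nat.strong_induction_on with
    | _ m ih =>
      intro hm
      have h := HopfAlgebra.mul_antipode_rTensor_comul_apply (R := k) (E m)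
      rw [hcomul m hm] at h
      simp only [map_sum, LinearMap.rTensor_tmul, LinearMap.mul'_apply] at h
      rw [← Finset.add_sum_erase _ _
        (show (m, 0) ∈ Finset.HasAntidiagonal.antidiagonal m by simp), hE.zero, mul_one] at h
      rw [eq_sub_of_add_eq h]
      refine sub_mem (Subalgebra.algebraMap_mem _ _) (sum_mem ?_)
      rintro ⟨i, j⟩ hij
      simp only [Finset.mem_erase, Finset.HasAntidiagonal.mem_antidiagonal, ne_eq, Prod.mk.injEq] at hij
      exact mul_mem (ih i (by omega) (by omega)) (hmem j (by omega))
  constructor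
  · intro x hx
    have : ncWittSubalgebra p E ℓ ≤ (Algebra.TensorProduct.map (ncWittSubalgebra p E ℓ).val
        (ncWittSubalgebra p E ℓ).val).range.comap (comulAlgHom k (NSymm k)) := by
      refine Algebra.adjoin_le ?_
      rintro _ ⟨i, hi, rfl⟩
      have hi' : p ^ i ≤ p ^ ℓ := Nat.pow_le_pow_right hp.le hi
      change comul (E (p ^ i)) ∈ (Algebra.TensorProduct.map (ncWittSubalgebra p E ℓ).val
        (ncWittSubalgebra p E ℓ).val).range
      rw [hcomul _ hi']
      refine sum_mem ?_
      rintro ⟨a, b⟩ hab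
      rw [Finset.HasAntidiagonal.mem_antidiagonal] at hab
      exact ⟨⟨E a, hmem a (by simp at hab; omega)⟩ ⊗ₜ ⟨E b, hmem b (by simp at hab; omega)⟩,
        by simp⟩
    exact this hx
  · intro x hx
    refine Algebra.adjoin_induction (p := fun x _ => HopfAlgebra.antipode k x ∈
      ncWittSubalgebra p E ℓ) ?_ ?_ ?_ ?_ hx
    · rintro _ ⟨i, hi, rfl⟩
      exact hanti _ (Nat.pow_le_pow_right hp.le hi)
    · intro r
      rw [Algebra.algebraMap_eq_smul_one, map_smul, HopfAlgebra.antipode_one]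
      exact Subalgebra.smul_mem _ (one_mem _) r
    · intro x y _ _ hx hy
      rw [map_add]; exact add_mem hx hy
    · intro x y _ _ hx hy
      rw [HopfAlgebra.antipode_mul_antidistrib]; exact mul_mem hy hx

/-- The non-commutative Witt Hopf algebra `NW_{ℓ+1} = k{E_{p^0}, …, E_{p^ℓ}}`, a Hopf subalgebra of
`NSymm k`. -/
noncomputable def ncWitt (hE : IsHomogeneousMinimalCurve k p L E) {ℓ : ℕ}
    (hℓ : ((p ^ ℓ : ℕ) : ℕ∞) ≤ L) : HopfAlgCat.{u} k :=
  letI := (hE.isHopf_ncWittSubalgebra hℓ).hopfAlgebra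
  HopfAlgCat.of k (ncWittSubalgebra p E ℓ)

/-- The element `E_{p^i}` of `NW_{ℓ+1}`, for `i ≤ ℓ`. -/
noncomputable def ncWitt.gen (hE : IsHomogeneousMinimalCurve k p L E) {ℓ : ℕ}
    (hℓ : ((p ^ ℓ : ℕ) : ℕ∞) ≤ L) (i : ℕ) (hi : i ≤ ℓ) : ncWitt hE hℓ :=
  show ncWittSubalgebra p E ℓ from ⟨E (p ^ i), Algebra.subset_adjoin ⟨i, hi, rfl⟩⟩

end NCWitt

/-! ### The Hopf algebra attached to a finite local algebra -/

section LocalAlgebra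

open IsLocalRing

universe v

variable (k : Type u) (A : Type v) [Field k] [CommRing A] [Algebra k A]

theorem finite_maximalIdeal [IsLocalRing A] [Module.Finite k A] :
    Module.Finite k (maximalIdeal A) :=
  Module.Finite.of_injective ((maximalIdeal A).subtype.restrictScalars k) Subtype.val_injective

/-- For a local `k`-algebra `A` with maximal ideal `𝔪`, the tensor algebra `T(𝔪*)` of the dual of
`𝔪`. -/
def LocalHopf [IsLocalRing A] : Type (max u v) :=
  TensorAlgebra k (Module.Dual k (maximalIdeal A))

namespace LocalHopf

variable [IsLocalRing A]

noncomputable instance : Ring (LocalHopf k A) :=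
  inferInstanceAs (Ring (TensorAlgebra k (Module.Dual k (maximalIdeal A))))
noncomputable instance : Algebra k (LocalHopf k A) :=
  inferInstanceAs (Algebra k (TensorAlgebra k (Module.Dual k (maximalIdeal A))))

/-- The inclusion `𝔪* → T(𝔪*)`. -/
noncomputable def ι : Module.Dual k (maximalIdeal A) →ₗ[k] LocalHopf k A := TensorAlgebra.ι k

/-- The extension of a linear map on `𝔪*` to an algebra map on `T(𝔪*)`. -/
noncomputable def lift {B : Type*} [Ring B] [Algebra k B]
    (f : Module.Dual k (maximalIdeal A) →ₗ[k] B) : LocalHopf k A →ₐ[k] B := TensorAlgebra.lift k f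

theorem lift_ι {B : Type*} [Ring B] [Algebra k B]
    (f : Module.Dual k (maximalIdeal A) →ₗ[k] B) (φ : Module.Dual k (maximalIdeal A)) :
    lift k A f (ι k A φ) = f φ := TensorAlgebra.lift_ι_apply _ _

theorem algHom_ext {B : Type*} [Ring B] [Algebra k B] {f g : LocalHopf k A →ₐ[k] B}
    (h : ∀ φ, f (ι k A φ) = g (ι k A φ)) : f = g :=
  TensorAlgebra.hom_ext (LinearMap.ext h)

theorem adjoin_range_ι : Algebra.adjoin k (Set.range (ι k A)) = ⊤ :=
  TensorAlgebra.adjoin_range_ι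

/-- The multiplication map `𝔪 ⊗ 𝔪 → 𝔪`. -/
noncomputable def mulMap : maximalIdeal A ⊗[k] maximalIdeal A →ₗ[k] maximalIdeal A :=
  TensorProduct.lift (LinearMap.mk₂ k (fun a b => a * b) add_mul
    (fun _ _ _ => Subtype.ext (by simp)) mul_add (fun _ _ _ => Subtype.ext (by simp)))

theorem mulMap_tmul (a b : maximalIdeal A) : mulMap k A (a ⊗ₜ b) = a * b := rfl

variable [Module.Finite k A]

/-- The transpose `Δ₀ : 𝔪* → (𝔪 ⊗ 𝔪)* = 𝔪* ⊗ 𝔪*` of the multiplication of `𝔪`. -/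
noncomputable def mulTranspose : Module.Dual k (maximalIdeal A) →ₗ[k]
    Module.Dual k (maximalIdeal A) ⊗[k] Module.Dual k (maximalIdeal A) :=
  haveI := finite_maximalIdeal k A
  (TensorProduct.dualDistribEquiv k (maximalIdeal A) (maximalIdeal A)).symm.toLinearMap ∘ₗ
    (mulMap k A).dualMap

theorem mulTranspose_eq_sum {n : Type*} [Fintype n] [DecidableEq n]
    (b : Module.Basis n k (maximalIdeal A)) (φ : Module.Dual k (maximalIdeal A)) :
    mulTranspose k A φ = ∑ i, ∑ j, φ (b i * b j) • (b.coord i ⊗ₜ[k] b.coord j) := by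
  have := finite_maximalIdeal k A
  rw [mulTranspose, LinearMap.comp_apply, LinearEquiv.coe_toLinearMap, LinearEquiv.symm_apply_eq]
  refine (b.tensorProduct b).ext ?_
  rintro ⟨i, j⟩
  have : TensorProduct.dualDistribEquiv k (maximalIdeal A) (maximalIdeal A)
      (∑ i, ∑ j, φ (b i * b j) • (b.coord i ⊗ₜ[k] b.coord j)) =
      TensorProduct.dualDistrib k (maximalIdeal A) (maximalIdeal A)
      (∑ i, ∑ j, φ (b i * b j) • (b.coord i ⊗ₜ[k] b.coord j)) := rfl
  rw [this]
  simp [LinearMap.dualMap_apply, mulMap_tmul, Finsupp.single_apply]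

/-- The comultiplication: the algebra map with `φ ↦ φ ⊗ 1 + 1 ⊗ φ + Δ₀(φ)` for `φ ∈ 𝔪*`. -/
noncomputable def comulHom : LocalHopf k A →ₐ[k] LocalHopf k A ⊗[k] LocalHopf k A :=
  lift k A (TensorProduct.map (ι k A) (ι k A) ∘ₗ mulTranspose k A +
    (TensorProduct.mk k _ _).flip 1 ∘ₗ ι k A + TensorProduct.mk k _ _ 1 ∘ₗ ι k A)

/-- The counit: the algebra map with `φ ↦ 0` for `φ ∈ 𝔪*`. -/
noncomputable def counitHom : LocalHopf k A →ₐ[k] k := lift k A 0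

theorem counitHom_ι (φ : Module.Dual k (maximalIdeal A)) : counitHom k A (ι k A φ) = 0 :=
  lift_ι _ _ _ _

theorem comulHom_ι {n : Type*} [Fintype n] [DecidableEq n]
    (b : Module.Basis n k (maximalIdeal A)) (φ : Module.Dual k (maximalIdeal A)) :
    comulHom k A (ι k A φ) =
      (∑ i, ∑ j, φ (b i * b j) • (ι k A (b.coord i) ⊗ₜ[k] ι k A (b.coord j))) +
        ι k A φ ⊗ₜ 1 + 1 ⊗ₜ ι k A φ := by
  rw [comulHom, lift_ι, LinearMap.add_apply, LinearMap.add_apply, LinearMap.comp_apply,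
    mulTranspose_eq_sum k A b]
  simp

theorem sum_coord_mul {n : Type*} [Fintype n]
    (b : Module.Basis n k (maximalIdeal A)) (φ : Module.Dual k (maximalIdeal A))
    (x y : maximalIdeal A) : ∑ l, b.coord l x * φ (b l * y) = φ (x * y) := by
  conv_rhs => rw [← b.sum_repr x, Finset.sum_mul, map_sum]
  refine Finset.sum_congr rfl fun l _ => ?_
  rw [show (b.repr x l • b l) * y = b.repr x l • (b l * y) from Subtype.ext (by simp), map_smul, smul_eq_mul, Module.Basis.coord_apply]

theorem sum_mul_coord {n : Type*} [Fintype n]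
    (b : Module.Basis n k (maximalIdeal A)) (φ : Module.Dual k (maximalIdeal A))
    (x y : maximalIdeal A) : ∑ l, b.coord l y * φ (x * b l) = φ (x * y) := by
  conv_rhs => rw [← b.sum_repr y, Finset.mul_sum, map_sum]
  refine Finset.sum_congr rfl fun l _ => ?_
  rw [show x * (b.repr y l • b l) = b.repr y l • (x * b l) from Subtype.ext (by simp), map_smul, smul_eq_mul, Module.Basis.coord_apply]

theorem sum_assoc_left {n W : Type*} [Fintype n] [AddCommGroup W] [Module k W]
    (b : Module.Basis n k (maximalIdeal A)) (φ : Module.Dual k (maximalIdeal A))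
    (t : n → n → n → W) :
    ∑ l, ∑ j, φ (b l * b j) • (∑ i, ∑ i', b.coord l (b i * b i') • t i i' j) =
      ∑ i, ∑ i', ∑ j, φ (b i * b i' * b j) • t i i' j := by
  simp_rw [← fun i i' j => sum_coord_mul k A b φ (b i * b i') (b j), Finset.sum_smul,
    Finset.smul_sum, smul_smul, mul_comm (φ _)]
  exact Finset.sum_comm.trans ((Finset.sum_congr rfl fun j _ => Finset.sum_comm).trans
    (Finset.sum_comm.trans ((Finset.sum_congr rfl fun i _ => Finset.sum_congr rfl fun j _ =>
    Finset.sum_comm).trans (Finset.sum_congr rfl fun i _ => Finset.sum_comm))))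

theorem sum_assoc_right {n W : Type*} [Fintype n] [AddCommGroup W] [Module k W]
    (b : Module.Basis n k (maximalIdeal A)) (φ : Module.Dual k (maximalIdeal A))
    (t : n → n → n → W) :
    ∑ i, ∑ l, φ (b i * b l) • (∑ i', ∑ j, b.coord l (b i' * b j) • t i i' j) =
      ∑ i, ∑ i', ∑ j, φ (b i * b i' * b j) • t i i' j := by
  simp_rw [mul_assoc, ← fun i i' j => sum_mul_coord k A b φ (b i) (b i' * b j),
    Finset.sum_smul, Finset.smul_sum, smul_smul, mul_comm (φ _)]
  exact Finset.sum_congr rfl fun i _ => Finset.sum_comm.trans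
    (Finset.sum_congr rfl fun i' _ => Finset.sum_comm)

noncomputable instance instBialgebra : Bialgebra k (LocalHopf k A) :=
  .ofAlgHom (comulHom k A) (counitHom k A)
    (algHom_ext k A fun φ => by
      classical
      have := finite_maximalIdeal k A
      let b := Module.Free.chooseBasis k (maximalIdeal A)
      let e : _ → LocalHopf k A := fun i => ι k A (b.coord i)
      have hc := comulHom_ι k A b
      have h3l := sum_assoc_left k A b φ fun i j l => e i ⊗ₜ[k] (e j ⊗ₜ[k] e l)
      have h3r := sum_assoc_right k A b φ fun i j l => e i ⊗ₜ[k] (e j ⊗ₜ[k] e l)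
      have he : ∀ i, ι k A (b.coord i) = e i := fun _ => rfl
      have hce := fun i => hc (b.coord i)
      simp only [he] at hce
      clear_value e
      simp only [AlgHom.comp_apply, AlgEquiv.toAlgHom_apply, hc, hce, map_sum, map_add, map_smul,
        Algebra.TensorProduct.map_tmul, AlgHom.id_apply, TensorProduct.sum_tmul,
        TensorProduct.tmul_sum, Algebra.TensorProduct.assoc_tmul, TensorProduct.add_tmul,
        TensorProduct.tmul_add, map_one, smul_add, Finset.sum_add_distrib,
        Algebra.TensorProduct.one_def, ← TensorProduct.smul_tmul', TensorProduct.tmul_smul, he, h3l, h3r]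
      abel)
    (algHom_ext k A fun φ => by
      classical
      have := finite_maximalIdeal k A
      let b := Module.Free.chooseBasis k (maximalIdeal A)
      simp [comulHom_ι k A b, counitHom_ι])
    (algHom_ext k A fun φ => by
      classical
      have := finite_maximalIdeal k A
      let b := Module.Free.chooseBasis k (maximalIdeal A)
      simp [comulHom_ι k A b, counitHom_ι])

theorem exists_antipode {n : Type*} [Fintype n] [DecidableEq n]
    (b : Module.Basis n k (maximalIdeal A)) :
    ∃ σ : Module.Dual k (maximalIdeal A) →ₗ[k] LocalHopf k A, ∀ φ,
      (∑ i, ∑ j, φ (b i * b j) • (σ (b.coord i) * ι k A (b.coord j))) + σ φ + ι k A φ = 0 ∧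
      (∑ i, ∑ j, φ (b i * b j) • (ι k A (b.coord i) * σ (b.coord j))) + ι k A φ + σ φ = 0 := by
  let V : ℕ → Submodule k (A ⊗[k] LocalHopf k A) := fun r =>
    Submodule.span k {x | ∃ a ∈ maximalIdeal A ^ r, ∃ h : LocalHopf k A, x = a ⊗ₜ h}
  have hV : ∀ r s x y, x ∈ V r → y ∈ V s → x * y ∈ V (r + s) := by
    intro r s x y hx hy
    have h1 : V r * V s ≤ V (r + s) := by
      rw [Submodule.span_mul_span]
      refine Submodule.span_mono ?_
      rintro _ ⟨_, ⟨a, ha, h, rfl⟩, _, ⟨a', ha', h', rfl⟩, rfl⟩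
      exact ⟨a * a', by rw [pow_add]; exact Ideal.mul_mem_mul ha ha', h * h', by simp⟩
    exact h1 (Submodule.mul_mem_mul hx hy)
  have hV0 : ∀ x, x ∈ V 0 := by
    intro x
    induction x with
    | zero => exact zero_mem _
    | add x y hx hy => exact add_mem hx hy
    | tmul a h => exact Submodule.subset_span ⟨a, by simp, h, rfl⟩
  have hV1 : ∀ x ∈ V 1, ∃ s : n → LocalHopf k A, x = ∑ i, ((b i : maximalIdeal A) : A) ⊗ₜ s i := by
    intro x hx
    induction hx using Submodule.span_induction with
    | mem x hx =>
      obtain ⟨a, ha, h, rfl⟩ := hx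
      rw [pow_one] at ha
      refine ⟨fun i => b.repr ⟨a, ha⟩ i • h, ?_⟩
      have := congrArg (Subtype.val) (b.sum_repr ⟨a, ha⟩)
      simp only [AddSubmonoidClass.coe_finsetSum, Submodule.coe_smul_of_tower] at this
      simp_rw [TensorProduct.tmul_smul, TensorProduct.smul_tmul', ← TensorProduct.sum_tmul, this]
    | zero => exact ⟨0, by simp⟩
    | add x y _ _ hx hy =>
      obtain ⟨s, rfl⟩ := hx
      obtain ⟨t, rfl⟩ := hy
      exact ⟨s + t, by simp [TensorProduct.tmul_add, Finset.sum_add_distrib]⟩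
    | smul r x _ hx =>
      obtain ⟨s, rfl⟩ := hx
      exact ⟨r • s, by simp [Finset.smul_sum]⟩
  let N : A ⊗[k] LocalHopf k A := ∑ i, ((b i : maximalIdeal A) : A) ⊗ₜ ι k A (b.coord i)
  have hN : N ∈ V 1 := sum_mem fun i _ => Submodule.subset_span ⟨b i, by simp, _, rfl⟩
  have hNr : ∀ r, N ^ r ∈ V r := by
    intro r
    induction r with
    | zero => exact hV0 _
    | succ r ih => rw [pow_succ]; exact hV _ _ _ _ ih hN
  have hnil : IsNilpotent N := by
    have : IsArtinianRing A := IsArtinianRing.of_finite k A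
    obtain ⟨r, hr⟩ := IsArtinianRing.isNilpotent_jacobson_bot (R := A)
    rw [IsLocalRing.jacobson_eq_maximalIdeal _ bot_ne_top] at hr
    refine ⟨r, ?_⟩
    have h := hNr r
    refine (Submodule.span_le (p := (⊥ : Submodule k (A ⊗[k] LocalHopf k A)))).2 ?_ h
    rintro _ ⟨a, ha, h, rfl⟩
    rw [hr] at ha
    have : a = 0 := by simpa using ha
    simp [this]
  obtain ⟨v, hv⟩ := hnil.isUnit_one_add
  have hr : (1 + N) * (↑v⁻¹ : A ⊗[k] LocalHopf k A) = 1 := by rw [← hv]; simp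
  have hl : (↑v⁻¹ : A ⊗[k] LocalHopf k A) * (1 + N) = 1 := by rw [← hv]; simp
  obtain ⟨s, hs⟩ := hV1 _ (hV 1 0 N (-↑v⁻¹) hN (hV0 _))
  have hv' : (↑v⁻¹ : A ⊗[k] LocalHopf k A) = 1 + ∑ i, ((b i : maximalIdeal A) : A) ⊗ₜ s i := by
    rw [← hs]
    rw [add_mul, one_mul] at hr
    rw [mul_neg, ← sub_eq_add_neg]
    exact eq_sub_of_add_eq hr
  rw [hv'] at hr hl
  obtain ⟨P, hP⟩ := LinearMap.exists_leftInverse_of_injective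
    ((maximalIdeal A).subtype.restrictScalars k) (LinearMap.ker_eq_bot.2 Subtype.val_injective)
  have hP' : ∀ x : maximalIdeal A, P x = x := fun x => LinearMap.congr_fun hP x
  have hPm : ∀ x y : maximalIdeal A, P ((x : A) * y) = x * y := fun x y => hP' (x * y)
  let σ : Module.Dual k (maximalIdeal A) →ₗ[k] LocalHopf k A :=
    ∑ i, (LinearMap.applyₗ (b i)).smulRight (s i)
  have hσ : ∀ φ, σ φ = ∑ i, φ (b i) • s i := fun φ => by simp [σ]
  have hσc : ∀ i, σ (b.coord i) = s i := fun i => by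
    rw [hσ]; simp [Finsupp.single_apply]
  have hι : ∀ φ, ι k A φ = ∑ i, φ (b i) • ι k A (b.coord i) := fun φ => by
    have h : φ = ∑ i, φ (b i) • b.coord i := b.ext fun j => by simp
    conv_lhs => rw [h, map_sum]
    simp only [map_smul]
  have hl' : (∑ i, ((b i : maximalIdeal A) : A) ⊗ₜ[k] s i) * N +
      (∑ i, ((b i : maximalIdeal A) : A) ⊗ₜ[k] s i) + N = 0 := by
    simp only [mul_add, add_mul, mul_one, one_mul, add_assoc, add_eq_left] at hl
    rw [← hl]
    abel
  have hr' : N * (∑ i, ((b i : maximalIdeal A) : A) ⊗ₜ[k] s i) + N +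
      (∑ i, ((b i : maximalIdeal A) : A) ⊗ₜ[k] s i) = 0 := by
    simp only [mul_add, add_mul, mul_one, one_mul, add_assoc, add_eq_left] at hr
    rw [← hr]
    abel
  refine ⟨σ, fun φ => ⟨?_, ?_⟩⟩
  · have h := congrArg (TensorProduct.lid k _ ∘ (φ ∘ₗ P).rTensor (LocalHopf k A)) hl'
    simp only [N, Function.comp_apply, map_add, Finset.sum_mul_sum, map_sum,
      Algebra.TensorProduct.tmul_mul_tmul, LinearMap.rTensor_tmul, TensorProduct.lid_tmul,
      LinearMap.comp_apply, hP', hPm, map_zero] at h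
    simpa only [hσc, hσ φ, hι φ] using h
  · have h := congrArg (TensorProduct.lid k _ ∘ (φ ∘ₗ P).rTensor (LocalHopf k A)) hr'
    simp only [N, Function.comp_apply, map_add, Finset.sum_mul_sum, map_sum,
      Algebra.TensorProduct.tmul_mul_tmul, LinearMap.rTensor_tmul, TensorProduct.lid_tmul,
      LinearMap.comp_apply, hP', hPm, map_zero] at h
    simpa only [hσc, hσ φ, hι φ] using h

noncomputable instance instHopfAlgebra : HopfAlgebra k (LocalHopf k A) :=
  haveI := finite_maximalIdeal k A
  .ofGenerators (lift k A ((MulOpposite.opLinearEquiv k).toLinearMap ∘ₗ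
      letI := Classical.decEq (Module.Free.ChooseBasisIndex k (maximalIdeal A))
      (exists_antipode k A (Module.Free.chooseBasis k (maximalIdeal A))).choose))
    (Set.range (ι k A)) (adjoin_range_ι k A)
    (by
      classical
      rintro _ ⟨φ, rfl⟩
      have h := ((exists_antipode k A
        (Module.Free.chooseBasis k (maximalIdeal A))).choose_spec φ).1
      change LinearMap.mul' k _ (LinearMap.rTensor _ _ (comulHom k A (ι k A φ))) =
        algebraMap k _ (counitHom k A (ι k A φ))
      rw [comulHom_ι k A (Module.Free.chooseBasis k (maximalIdeal A)), counitHom_ι, map_zero]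
      simp only [map_add, map_sum, map_smul, LinearMap.rTensor_tmul, LinearMap.comp_apply,
        AlgHom.toLinearMap_apply, lift_ι, map_one, LinearMap.mul'_apply]
      simpa using h)
    (by
      classical
      rintro _ ⟨φ, rfl⟩
      have h := ((exists_antipode k A
        (Module.Free.chooseBasis k (maximalIdeal A))).choose_spec φ).2
      change LinearMap.mul' k _ (LinearMap.lTensor _ _ (comulHom k A (ι k A φ))) =
        algebraMap k _ (counitHom k A (ι k A φ))
      rw [comulHom_ι k A (Module.Free.chooseBasis k (maximalIdeal A)), counitHom_ι, map_zero]
      simp only [map_add, map_sum, map_smul, LinearMap.lTensor_tmul, LinearMap.comp_apply,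
        AlgHom.toLinearMap_apply, lift_ι, map_one, LinearMap.mul'_apply]
      simpa using h)

end LocalHopf

/-- The least `i` such that the `i`-th power of the Frobenius `a ↦ a ^ p` kills the maximal
ideal. -/
noncomputable def frobeniusHeight (p : ℕ) (A : Type*) [CommRing A] [IsLocalRing A] : ℕ :=
  sInf {i : ℕ | ∀ a ∈ maximalIdeal A, a ^ p ^ i = 0}

end LocalAlgebra

/-! Choose a basis `b i` of `𝔪`. An algebra map from `H_A` to an algebra `U` is a linear map on
`𝔪*`, that is, an element `g = 1 + ∑ b i ⊗ f i` of `A ⊗ U`, where `f i` is the image of the `i`-th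
dual basis vector. Because `Δ₀` is the transpose of multiplication, the map is one of bialgebras
exactly when `g` is group-like over `A`: `Δ(g) = (g ⊗ 1)(1 ⊗ g)` and `ε(g) = 1`.

Height one supplies such elements. If `a ^ p = 0` and `u` is primitive, the exponential of `a ⊗ u`
truncated below degree `p` makes sense in characteristic `p` and is group-like, since the terms that
truncation would spoil contain `a ^ r` with `r ≥ p` (`truncExp_add`, `baseComul_truncExp`). Products
of group-like elements are group-like (`baseComul_prod_truncExp`).

Let `U` be free as an algebra on primitive elements `u i`, one for each `b i`, and let `g` be the
ordered product of the exponentials of `b i ⊗ u i`. As `𝔪` is nilpotent, the basis can be chosen so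
that `𝔪 * b i` lies in the span of the earlier basis vectors (`exists_triangular_basis`). Then `f i`
is `u i` plus an element of the subalgebra generated by the `u j` with `j > i`
(`exists_prod_truncExp_eq`), and a triangular substitution of this kind is bijective on a free
algebra (`FreeAlgebra.bijective_of_triangular`). Hence `H_A` is isomorphic to `U`
(`LocalHopf.nonempty_equiv_of_pow_eq_zero`).

The enveloping algebra of a free Lie algebra is such a `U`. For the coproduct, bialgebra maps out of
an algebra freely generated by primitives are families of primitive elements of the target. `NW₁` is
free on the single primitive `E₁ = Z₁`, so `H_A` has the universal property of a coproduct of copies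
of it (`exists_isColimit_cofan`). -/

/-! ### Truncated exponentials -/

/-- The exponential series truncated below degree `p`. -/
noncomputable def truncExp (k : Type*) {B : Type*} [Field k] [Ring B] [Algebra k B] (p : ℕ)
    (x : B) : B :=
  ∑ r ∈ Finset.range p, (r.factorial : k)⁻¹ • x ^ r

theorem map_truncExp {k B C : Type*} [Field k] [Ring B] [Algebra k B] [Ring C] [Algebra k C]
    (f : B →ₐ[k] C) (p : ℕ) (x : B) : f (truncExp k p x) = truncExp k p (f x) := by
  simp [truncExp]

theorem truncExp_zero (k : Type*) {B : Type*} [Field k] [Ring B] [Algebra k B] {p : ℕ}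
    (hp : 0 < p) : truncExp k p (0 : B) = 1 := by
  rw [truncExp, Finset.sum_eq_single 0]
  · simp
  · intro r _ hr
    simp [hr]
  · intro h
    simp [hp.ne'] at h

/-- The usual binomial proof of `exp (s + t) = exp s * exp t` works in total degree below `p`, where
the factorials are invertible. The product on the right has further terms, of total degree at least
`p`, and `h` kills them. -/
theorem truncExp_add {k B : Type*} [Field k] [Ring B] [Algebra k B] {p : ℕ}
    (hp : ∀ r < p, (r.factorial : k) ≠ 0) {s t : B} (hst : Commute s t)
    (h : ∀ i j, p ≤ i + j → s ^ i * t ^ j = 0) :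
    truncExp k p (s + t) = truncExp k p s * truncExp k p t := by
  let g : ℕ × ℕ → B := fun m =>
    ((m.1.factorial : k)⁻¹ * (m.2.factorial : k)⁻¹) • (s ^ m.1 * t ^ m.2)
  have hl : ∀ r ∈ Finset.range p, (r.factorial : k)⁻¹ • (s + t) ^ r =
      ∑ m ∈ Finset.HasAntidiagonal.antidiagonal r, g m := by
    intro r hr
    rw [hst.add_pow', Finset.smul_sum]
    refine Finset.sum_congr rfl fun m hm => ?_
    rw [Finset.HasAntidiagonal.mem_antidiagonal] at hm
    rw [← Nat.cast_smul_eq_nsmul k, smul_smul]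
    congr 1
    have hr' := Finset.mem_range.1 hr
    have h0 := hp r hr'
    have h1 := hp m.1 (by omega)
    have h2 := hp m.2 (by omega)
    have h3 := congrArg (Nat.cast (R := k)) (Nat.add_choose_mul_factorial_mul_factorial m.1 m.2)
    rw [← Nat.choose_symm_add, hm] at h3
    push_cast at h3
    field_simp
    linear_combination h3
  have hr : truncExp k p s * truncExp k p t = ∑ m ∈ Finset.range p ×ˢ Finset.range p, g m := by
    rw [truncExp, truncExp, Finset.sum_mul_sum, Finset.sum_product]
    simp [g, smul_smul, mul_comm]
  -- The square of exponent pairs is cut down to the triangle `m.1 + m.2 < p`, then sliced by total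
  -- degree; each slice is an antidiagonal.
  rw [hr, truncExp, Finset.sum_congr rfl hl,
    ← Finset.sum_filter_of_ne (p := fun m : ℕ × ℕ => m.1 + m.2 < p),
    ← Finset.sum_fiberwise_of_maps_to (g := fun m : ℕ × ℕ => m.1 + m.2) (t := Finset.range p)]
  · refine Finset.sum_congr rfl fun r hr => Finset.sum_congr ?_ fun _ _ => rfl
    ext m
    simp only [Finset.HasAntidiagonal.mem_antidiagonal, Finset.mem_filter, Finset.mem_product,
      Finset.mem_range] at hr ⊢
    omega
  · intro m hm
    simpa using (Finset.mem_filter.1 hm).2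
  · intro m _ hm
    by_contra hlt
    exact hm (by simp [g, h m.1 m.2 (not_lt.1 hlt)])

theorem factorial_cast_ne_zero (k : Type*) [Field k] (p : ℕ) [CharP k p] [hp : Fact p.Prime]
    (r : ℕ) (hr : r < p) : (r.factorial : k) ≠ 0 := by
  rw [Ne, CharP.cast_eq_zero_iff k p, hp.out.dvd_factorial]
  omega

/-! ### Triangular endomorphisms of free algebras -/

/-- Both halves are recursions from the top index down: one solves for a left inverse of `θ`, the
other shows that each generator lies in the range once all larger ones do. -/
theorem FreeAlgebra.bijective_of_triangular {k σ : Type*} [CommRing k] [LinearOrder σ]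
    [WellFoundedGT σ] (θ : FreeAlgebra k σ →ₐ[k] FreeAlgebra k σ)
    (h : ∀ i, θ (ι k i) - ι k i ∈ Algebra.adjoin k (ι k '' Set.Ioi i)) :
    Function.Bijective θ := by
  classical
  constructor
  -- `G i` is forced by the equation `lift G (θ (ι i)) = ι i`. The value `0` at indices not above
  -- `i` is a dummy: the argument of the lift involves only generators of index greater than `i`.
  · let G : σ → FreeAlgebra k σ := (wellFounded_gt (α := σ)).fix fun i G =>
      ι k i - lift k (fun j => if hj : j > i then G j hj else 0) (θ (ι k i) - ι k i)
    have hG : ∀ i, G i = ι k i - lift k G (θ (ι k i) - ι k i) := by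
      intro i
      rw [show G i = _ from (wellFounded_gt (α := σ)).fix_eq _ i]
      congr 1
      refine AlgHom.eqOn_adjoin_iff.2 ?_ (h i)
      rintro _ ⟨j, hj, rfl⟩
      have hj' : i < j := hj
      simp [hj', G]
    have hid : (lift k G).comp θ = AlgHom.id k _ := by
      ext i
      have := hG i
      rw [map_sub, lift_ι_apply] at this
      simp only [Function.comp_apply, AlgHom.comp_apply, AlgHom.id_apply]
      rwa [eq_sub_iff_add_eq, add_sub_cancel] at this
    exact Function.LeftInverse.injective (g := lift k G) fun x => DFunLike.congr_fun hid x
  · have hι : ∀ i, ι k i ∈ θ.range := by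
      intro i
      induction i using (wellFounded_gt (α := σ)).induction with
      | _ i ih =>
        have h1 : Algebra.adjoin k (ι k '' Set.Ioi i) ≤ θ.range := by
          refine Algebra.adjoin_le ?_
          rintro _ ⟨j, hj, rfl⟩
          exact ih j hj
        have h2 := sub_mem (AlgHom.mem_range_self θ (ι k i)) (h1 (h i))
        simpa using h2
    rw [← AlgHom.range_eq_top, eq_top_iff, ← FreeAlgebra.adjoin_range_ι]
    refine Algebra.adjoin_le ?_
    rintro _ ⟨i, rfl⟩
    exact hι i

/-! ### Triangular bases of the maximal ideal -/

section TriangularBasis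

open IsLocalRing

variable (k A : Type*) [Field k] [CommRing A] [Algebra k A] [Module.Finite k A] [IsLocalRing A]

/-- Some power of `𝔪` lies in `W` by nilpotency. An element outside `W` of the last power not
contained in `W` will do, since `𝔪` moves it into the next power. -/
theorem exists_notMem_forall_mul_mem (W : Submodule k (maximalIdeal A)) (hW : W ≠ ⊤) :
    ∃ x ∉ W, ∀ a : maximalIdeal A, a * x ∈ W := by
  classical
  have hex : ∃ r : ℕ, ∀ x : maximalIdeal A, (x : A) ∈ maximalIdeal A ^ (r + 1) → x ∈ W := by
    have : IsArtinianRing A := IsArtinianRing.of_finite k A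
    obtain ⟨r, hr⟩ := IsArtinianRing.isNilpotent_jacobson_bot (R := A)
    rw [IsLocalRing.jacobson_eq_maximalIdeal _ bot_ne_top] at hr
    refine ⟨r, fun x hx => ?_⟩
    rw [pow_succ, hr, zero_mul] at hx
    have : x = 0 := Subtype.ext (by simpa using hx)
    simp [this]
  have hspec := Nat.find_spec hex
  -- The exponent in `hex` is `r + 1`, so the value `0` would mean that `𝔪` itself lies in `W`,
  -- against `hW`.
  rcases hr : Nat.find hex with _ | r
  · rw [hr] at hspec
    exact absurd (eq_top_iff.2 fun x _ => hspec x (by simp)) hW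
  · have hmin := Nat.find_min hex (m := r) (by omega)
    push Not at hmin
    obtain ⟨x, hx, hxW⟩ := hmin
    rw [hr] at hspec
    refine ⟨x, hxW, fun a => hspec _ ?_⟩
    rw [pow_succ' _ (r + 1)]
    exact Ideal.mul_mem_mul a.2 hx

/-- The family grows one vector at a time: the new one is annihilated by `𝔪` modulo the span of
those already chosen. -/
theorem exists_triangular_linearIndependent (d : ℕ)
    (hd : d ≤ Module.finrank k (maximalIdeal A)) :
    ∃ v : Fin d → maximalIdeal A, LinearIndependent k v ∧
      ∀ a i, a * v i ∈ Submodule.span k (v '' Set.Iio i) := by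
  have := finite_maximalIdeal k A
  induction d with
  | zero => exact ⟨Fin.elim0, linearIndependent_empty_type, fun _ i => i.elim0⟩
  | succ d ih =>
    obtain ⟨v, hv, hm⟩ := ih (by omega)
    have hW : Submodule.span k (Set.range v) ≠ ⊤ := by
      intro h
      have h1 := finrank_span_eq_card hv
      rw [h, finrank_top, Fintype.card_fin] at h1
      omega
    obtain ⟨x, hx, hax⟩ := exists_notMem_forall_mul_mem k A _ hW
    refine ⟨Fin.snoc v x, linearIndependent_finSnoc.2 ⟨hv, hx⟩, fun a i => ?_⟩
    induction i using Fin.lastCases with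
    | last =>
      rw [Fin.snoc_last]
      refine Submodule.span_mono ?_ (hax a)
      rintro _ ⟨j, rfl⟩
      exact ⟨j.castSucc, Fin.castSucc_lt_last j, Fin.snoc_castSucc _ _ _⟩
    | cast i =>
      rw [Fin.snoc_castSucc]
      refine Submodule.span_mono ?_ (hm a i)
      rintro _ ⟨j, hj, rfl⟩
      exact ⟨j.castSucc, Fin.castSucc_lt_castSucc_iff.2 hj, Fin.snoc_castSucc _ _ _⟩

theorem exists_triangular_basis :
    ∃ b : Module.Basis (Fin (Module.finrank k (maximalIdeal A))) k (maximalIdeal A),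
      ∀ a i, a * b i ∈ Submodule.span k (b '' Set.Iio i) := by
  have := finite_maximalIdeal k A
  obtain ⟨v, hv, hm⟩ := exists_triangular_linearIndependent k A _ le_rfl
  refine ⟨Module.Basis.mk hv (hv.span_eq_top_of_card_eq_finrank' (by simp)).ge, ?_⟩
  simpa using hm

end TriangularBasis

/-! ### Triangular shape of products of truncated exponentials. -/

section TriangularSpan

open IsLocalRing

variable {k A U : Type*} [Field k] [CommRing A] [Algebra k A] [IsLocalRing A] [Ring U]
  [Algebra k U] {n : ℕ} (b : Module.Basis (Fin n) k (maximalIdeal A))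

/-- The elements `∑ bₗ ⊗ rₗ` of `𝔪 ⊗ U` with `rₗ` in a prescribed subalgebra `R l`. -/
noncomputable def coordSpan (R : Fin n → Subalgebra k U) : Submodule k (A ⊗[k] U) :=
  Submodule.span k {x | ∃ l, ∃ r ∈ R l, x = (b l : A) ⊗ₜ r}

theorem tmul_mem_coordSpan {R : Fin n → Subalgebra k U} {l : Fin n} {r : U} (hr : r ∈ R l) :
    (b l : A) ⊗ₜ r ∈ coordSpan b R :=
  Submodule.subset_span ⟨l, r, hr, rfl⟩

theorem coordSpan_mono {R R' : Fin n → Subalgebra k U} (h : R ≤ R') :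
    coordSpan b R ≤ coordSpan b R' := by
  refine Submodule.span_le.2 ?_
  rintro _ ⟨l, r, hr, rfl⟩
  exact tmul_mem_coordSpan b (h l hr)

theorem exists_eq_sum_of_mem_coordSpan {R : Fin n → Subalgebra k U} {x : A ⊗[k] U}
    (hx : x ∈ coordSpan b R) : ∃ r : Fin n → U, (∀ l, r l ∈ R l) ∧ x = ∑ l, (b l : A) ⊗ₜ r l := by
  classical
  induction hx using Submodule.span_induction with
  | mem x hx =>
    obtain ⟨l, r, hr, rfl⟩ := hx
    refine ⟨Pi.single l r, fun j => ?_, ?_⟩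
    · rcases eq_or_ne j l with rfl | hj
      · simpa using hr
      · simp [hj, zero_mem]
    · rw [Finset.sum_eq_single l]
      · simp
      · intro j _ hj
        simp [hj]
      · simp
  | zero => exact ⟨0, fun l => zero_mem _, by simp⟩
  | add x y _ _ hx hy =>
    obtain ⟨r, hr, rfl⟩ := hx
    obtain ⟨s, hs, rfl⟩ := hy
    exact ⟨r + s, fun l => add_mem (hr l) (hs l), by
      simp [TensorProduct.tmul_add, Finset.sum_add_distrib]⟩
  | smul c x _ hx =>
    obtain ⟨r, hr, rfl⟩ := hx
    exact ⟨c • r, fun l => Subalgebra.smul_mem _ (hr l) c, by simp [Finset.smul_sum]⟩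

variable (k) in
/-- The subalgebra generated by the `uⱼ` with `j ≥ l`. -/
noncomputable def adjoinIci (u : Fin n → U) (l : Fin n) : Subalgebra k U :=
  Algebra.adjoin k (u '' Set.Ici l)

variable (k) in
/-- The subalgebra generated by the `uⱼ` with `j > l`. -/
noncomputable def adjoinIoi (u : Fin n → U) (l : Fin n) : Subalgebra k U :=
  Algebra.adjoin k (u '' Set.Ioi l)

variable (k) in
theorem adjoinIoi_le_adjoinIci (u : Fin n → U) : adjoinIoi k u ≤ adjoinIci k u := fun _ =>
  Algebra.adjoin_mono (Set.image_mono Set.Ioi_subset_Ici_self)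

variable (k) in
theorem adjoinIci_le_adjoinIoi (u : Fin n → U) {i l : Fin n} (h : l < i) :
    adjoinIci k u i ≤ adjoinIoi k u l :=
  Algebra.adjoin_mono (Set.image_mono fun _ hj => h.trans_le hj)

variable (k) in
theorem adjoinIci_anti (u : Fin n → U) {i j : Fin n} (h : i ≤ j) :
    adjoinIci k u j ≤ adjoinIci k u i :=
  Algebra.adjoin_mono (Set.image_mono (Set.Ici_subset_Ici.2 h))

variable {b} (hb : ∀ a i, a * b i ∈ Submodule.span k (b '' Set.Iio i))
include hb

/-- Multiplying by `𝔪` strictly lowers the index of the basis vector while the coefficient stays the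
same. A coefficient in generators of index at least `i` thus ends up at positions `l < i`, where it
involves only indices greater than `l`. -/
theorem basis_mul_tmul_mem (u : Fin n → U) {i : Fin n} (j : Fin n) {r : U}
    (hr : r ∈ adjoinIci k u i) : ((b j * b i : maximalIdeal A) : A) ⊗ₜ[k] r ∈
      coordSpan b (adjoinIoi k u) := by
  have h := hb (b j) i
  generalize b j * b i = y at h ⊢
  induction h using Submodule.span_induction with
  | mem x hx =>
    obtain ⟨l, hl, rfl⟩ := hx
    exact tmul_mem_coordSpan b (adjoinIci_le_adjoinIoi k u hl hr)
  | zero => simp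
  | add x y _ _ hx hy =>
    rw [Submodule.coe_add, TensorProduct.add_tmul]
    exact add_mem hx hy
  | smul c x _ hx =>
    rw [Submodule.coe_smul_of_tower, ← TensorProduct.smul_tmul']
    exact Submodule.smul_mem _ c hx

/-- This is the gain from weak to strict triangularity: every product of two or more factors is an
error term. Of the two basis vectors, the one with the smaller index is used to lower the position,
because both coefficients lie in its subalgebra. -/
theorem coordSpan_mul_le (u : Fin n → U) :
    coordSpan b (adjoinIci k u) * coordSpan b (adjoinIci k u) ≤ coordSpan b (adjoinIoi k u) := by
  conv_lhs => rw [coordSpan, Submodule.span_mul_span]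
  refine Submodule.span_le.2 ?_
  rintro _ ⟨_, ⟨i, r, hr, rfl⟩, _, ⟨j, s, hs, rfl⟩, rfl⟩
  simp only [Algebra.TensorProduct.tmul_mul_tmul, SetLike.mem_coe]
  rcases le_total i j with hij | hij
  · rw [mul_comm (b i : A)]
    exact basis_mul_tmul_mem hb u _ (mul_mem hr (adjoinIci_anti k u hij hs))
  · exact basis_mul_tmul_mem hb u _ (mul_mem (adjoinIci_anti k u hij hr) hs)

theorem truncExp_sub_mem (u : Fin n → U) (i : Fin n) {p : ℕ} (hp : 2 ≤ p) :
    truncExp k p ((b i : A) ⊗ₜ[k] u i) - 1 - (b i : A) ⊗ₜ[k] u i ∈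
      coordSpan b (adjoinIoi k u) := by
  have h1 : (b i : A) ⊗ₜ[k] u i ∈ coordSpan b (adjoinIci k u) :=
    tmul_mem_coordSpan b (Algebra.subset_adjoin ⟨i, Set.self_mem_Ici, rfl⟩)
  have hpow : ∀ r, ((b i : A) ⊗ₜ[k] u i) ^ (r + 1) ∈ coordSpan b (adjoinIci k u) := by
    intro r
    induction r with
    | zero => simpa only [zero_add, pow_one] using h1
    | succ r ih =>
      rw [pow_succ]
      exact coordSpan_mono b (adjoinIoi_le_adjoinIci k u)
        (coordSpan_mul_le hb u (Submodule.mul_mem_mul ih h1))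
  -- Writing `p = q + 2` splits off the constant and linear terms of the exponential; all the others
  -- are products of at least two factors.
  obtain ⟨q, rfl⟩ := Nat.exists_eq_add_of_le' hp
  rw [truncExp, Finset.sum_range_succ', Finset.sum_range_succ']
  simp only [zero_add, Nat.factorial_zero, Nat.factorial_one, Nat.cast_one, inv_one, one_smul,
    pow_zero, pow_one, add_sub_cancel_right]
  refine sum_mem fun r _ => Submodule.smul_mem _ _ ?_
  rw [pow_succ]
  exact coordSpan_mul_le hb u (Submodule.mul_mem_mul (hpow r) h1)

theorem prod_truncExp_sub_mem (u : Fin n → U) {p : ℕ} (hp : 2 ≤ p) (l : List (Fin n)) :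
    (l.map fun i => truncExp k p ((b i : A) ⊗ₜ[k] u i)).prod - 1 -
      (l.map fun i => (b i : A) ⊗ₜ[k] u i).sum ∈ coordSpan b (adjoinIoi k u) := by
  have hle := coordSpan_mono b (adjoinIoi_le_adjoinIci k u)
  have h1 : ∀ i, (b i : A) ⊗ₜ[k] u i ∈ coordSpan b (adjoinIci k u) := fun i =>
    tmul_mem_coordSpan b (Algebra.subset_adjoin ⟨i, Set.self_mem_Ici, rfl⟩)
  induction l with
  | nil => simp
  | cons i l ih =>
    simp only [List.map_cons, List.prod_cons, List.sum_cons]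
    have hi := truncExp_sub_mem hb u i hp
    set y := (b i : A) ⊗ₜ[k] u i
    have hy : y ∈ coordSpan b (adjoinIci k u) := h1 i
    set X := truncExp k p y
    set Y := (l.map fun i => truncExp k p ((b i : A) ⊗ₜ[k] u i)).prod
    have hs : (l.map fun i => (b i : A) ⊗ₜ[k] u i).sum ∈ coordSpan b (adjoinIci k u) :=
      list_sum_mem (by simpa using fun i _ => h1 i)
    set s := (l.map fun i => (b i : A) ⊗ₜ[k] u i).sum
    have hX : X - 1 ∈ coordSpan b (adjoinIci k u) := by
      simpa using add_mem (hle hi) hy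
    have hY : Y - 1 ∈ coordSpan b (adjoinIci k u) := by
      simpa using add_mem (hle ih) hs
    -- The identity behind this is `X * Y - 1 - (y + s) = (X - 1) * (Y - 1) + (X - 1 - y) + (Y - 1 -
    -- s)`.
    have h := add_mem (add_mem (coordSpan_mul_le hb u (Submodule.mul_mem_mul hX hY)) hi) ih
    convert h using 1
    noncomm_ring

theorem exists_prod_truncExp_eq (u : Fin n → U) {p : ℕ} (hp : 2 ≤ p) :
    ∃ f : Fin n → U, (∀ i, f i - u i ∈ Algebra.adjoin k (u '' Set.Ioi i)) ∧
      ((List.finRange n).map fun i => truncExp k p ((b i : A) ⊗ₜ[k] u i)).prod =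
        1 + ∑ i, (b i : A) ⊗ₜ[k] f i := by
  obtain ⟨r, hr, h⟩ := exists_eq_sum_of_mem_coordSpan b
    (prod_truncExp_sub_mem hb u hp (List.finRange n))
  refine ⟨u + r, fun i => by simpa [adjoinIoi] using hr i, ?_⟩
  rw [← Fin.sum_univ_def, sub_eq_iff_eq_add, sub_eq_iff_eq_add] at h
  rw [h]
  simp only [Pi.add_apply, TensorProduct.tmul_add, Finset.sum_add_distrib]
  abel

end TriangularSpan

/-! ### Primitive elements -/

section Primitive

variable {k : Type*} [Field k] {H H' : Type*} [Ring H] [Bialgebra k H] [Ring H'] [Bialgebra k H']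

/-- The counit axiom gives `ε(x) • 1 + x = x`, so `ε(x) • 1 = 0` in `H`; a second application of `ε`
brings this down to `k`. -/
theorem counit_eq_zero_of_comul_eq {x : H} (hx : comul (R := k) x = x ⊗ₜ 1 + 1 ⊗ₜ x) :
    counit (R := k) x = 0 := by
  have h := congrArg (TensorProduct.lid k H) (Coalgebra.rTensor_counit_comul (R := k) x)
  rw [hx] at h
  simp only [map_add, LinearMap.rTensor_tmul, TensorProduct.lid_tmul, Bialgebra.counit_one,
    one_smul, add_eq_right] at h
  have h' := congrArg (counit (R := k)) h
  simpa using h'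

/-- An algebra map that sends algebra generators which are primitive to primitive elements is a
bialgebra map. -/
noncomputable def BialgHom.ofPrimitive (f : H →ₐ[k] H') (s : Set H) (hs : Algebra.adjoin k s = ⊤)
    (h : ∀ x ∈ s, comul (R := k) x = x ⊗ₜ 1 + 1 ⊗ₜ x)
    (h' : ∀ x ∈ s, comul (R := k) (f x) = f x ⊗ₜ 1 + 1 ⊗ₜ f x) : H →ₐc[k] H' :=
  .ofAlgHom f
    (AlgHom.ext_of_adjoin_eq_top hs fun x hx => by
      simp [counit_eq_zero_of_comul_eq (h x hx), counit_eq_zero_of_comul_eq (h' x hx)])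
    (AlgHom.ext_of_adjoin_eq_top hs fun x hx => by simp [h x hx, h' x hx])

theorem BialgHom.comul_apply_of_primitive (f : H →ₐc[k] H') {x : H}
    (hx : comul (R := k) x = x ⊗ₜ 1 + 1 ⊗ₜ x) :
    comul (R := k) (f x) = f x ⊗ₜ 1 + 1 ⊗ₜ f x := by
  rw [← CoalgHomClass.map_comp_comul_apply f, hx]
  simp

end Primitive

/-! ### Group-like products of truncated exponentials -/

section GroupLike

variable {k A U : Type*} [Field k] [CommRing A] [Algebra k A] [Ring U] [Bialgebra k U]

variable (k A U) in
/-- The map `A ⊗ U → A ⊗ (U ⊗ U)` given by the comultiplication of `U`. -/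
noncomputable def baseComul : A ⊗[k] U →ₐ[k] A ⊗[k] (U ⊗[k] U) :=
  Algebra.TensorProduct.map (AlgHom.id k A) (comulAlgHom k U)

variable (k A U) in
/-- The map `A ⊗ U → A ⊗ (U ⊗ U)` given by `u ↦ u ⊗ 1`. -/
noncomputable def baseLeft : A ⊗[k] U →ₐ[k] A ⊗[k] (U ⊗[k] U) :=
  Algebra.TensorProduct.map (AlgHom.id k A) Algebra.TensorProduct.includeLeft

variable (k A U) in
/-- The map `A ⊗ U → A ⊗ (U ⊗ U)` given by `u ↦ 1 ⊗ u`. -/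
noncomputable def baseRight : A ⊗[k] U →ₐ[k] A ⊗[k] (U ⊗[k] U) :=
  Algebra.TensorProduct.map (AlgHom.id k A) Algebra.TensorProduct.includeRight

/-- The two copies of `U` commute inside `U ⊗ U`, and `A` is commutative. -/
theorem commute_baseLeft_baseRight (x y : A ⊗[k] U) :
    Commute (baseLeft k A U x) (baseRight k A U y) := by
  induction x with
  | zero => simp
  | add x x' hx hx' => rw [map_add]; exact hx.add_left hx'
  | tmul a u =>
    induction y with
    | zero => simp
    | add y y' hy hy' => rw [map_add]; exact hy.add_right hy'
    | tmul a' u' => simp [commute_iff_eq, baseLeft, baseRight, mul_comm]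

variable {p : ℕ} (hp : ∀ r < p, (r.factorial : k) ≠ 0)
include hp

/-- Primitivity makes the image of `a ⊗ u` a sum of the commuting elements `s = a ⊗ (u ⊗ 1)` and `t
= a ⊗ (1 ⊗ u)`. As `s ^ i * t ^ j` carries the factor `a ^ (i + j)`, it vanishes for `i + j ≥ p`, so
`truncExp_add` applies. -/
theorem baseComul_truncExp {a : A} {u : U} (ha : a ^ p = 0)
    (hu : comul (R := k) u = u ⊗ₜ 1 + 1 ⊗ₜ u) :
    baseComul k A U (truncExp k p (a ⊗ₜ[k] u)) = baseLeft k A U (truncExp k p (a ⊗ₜ[k] u)) *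
      baseRight k A U (truncExp k p (a ⊗ₜ[k] u)) := by
  rw [map_truncExp, map_truncExp, map_truncExp, ← truncExp_add hp (commute_baseLeft_baseRight _ _)]
  · simp [baseComul, baseLeft, baseRight, hu, TensorProduct.tmul_add]
  · intro i j hij
    simp [baseLeft, baseRight, Algebra.TensorProduct.tmul_pow, ← pow_add,
      pow_eq_zero_of_le hij ha]

theorem baseComul_prod_truncExp {ι : Type*} {a : ι → A} {u : ι → U} (ha : ∀ i, a i ^ p = 0)
    (hu : ∀ i, comul (R := k) (u i) = u i ⊗ₜ 1 + 1 ⊗ₜ u i) (l : List ι) :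
    baseComul k A U (l.map fun i => truncExp k p (a i ⊗ₜ[k] u i)).prod =
      baseLeft k A U (l.map fun i => truncExp k p (a i ⊗ₜ[k] u i)).prod *
      baseRight k A U (l.map fun i => truncExp k p (a i ⊗ₜ[k] u i)).prod := by
  induction l with
  | nil => simp
  | cons i l ih =>
    simp only [List.map_cons, List.prod_cons, map_mul]
    rw [ih, baseComul_truncExp hp (ha i) (hu i)]
    -- The right factor of the head passes the left factor of the tail, so group-like elements
    -- multiply.
    exact Commute.mul_mul_mul_comm (commute_baseLeft_baseRight _ _).symm _ _

end GroupLike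

/-! ### From group-like elements to an isomorphism out of `H_A`. -/

section LocalHopfEquiv

open IsLocalRing

variable {k A U : Type*} [Field k] [CommRing A] [Algebra k A] [IsLocalRing A]
  [Ring U] {n : ℕ} (b : Module.Basis (Fin n) k (maximalIdeal A))

namespace LocalHopf

/-- The algebra map `H_A → U` with values `f i` on the elements of a dual basis. -/
noncomputable def liftBasis [Algebra k U] (f : Fin n → U) : LocalHopf k A →ₐ[k] U :=
  lift k A (∑ i, (LinearMap.applyₗ (b i)).smulRight (f i))

theorem liftBasis_ι [Algebra k U] (f : Fin n → U) (φ : Module.Dual k (maximalIdeal A)) :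
    liftBasis b f (ι k A φ) = ∑ i, φ (b i) • f i := by
  simp [liftBasis, lift_ι]

theorem liftBasis_coord [Algebra k U] (f : Fin n → U) (i : Fin n) :
    liftBasis b f (ι k A (b.coord i)) = f i := by
  simp [liftBasis_ι, Finsupp.single_apply]

/-- The dual basis identifies the tensor algebra with the free algebra; read through this and `e`,
the map becomes a triangular endomorphism `θ`. -/
theorem bijective_liftBasis [Algebra k U] (e : FreeAlgebra k (Fin n) ≃ₐ[k] U) {f : Fin n → U}
    (hf : ∀ i, f i - e (FreeAlgebra.ι k i) ∈
      Algebra.adjoin k ((fun j => e (FreeAlgebra.ι k j)) '' Set.Ioi i)) :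
    Function.Bijective (liftBasis b f) := by
  let eH : LocalHopf k A ≃ₐ[k] FreeAlgebra k (Fin n) := TensorAlgebra.equivFreeAlgebra b.dualBasis
  have heH : ∀ i, eH.symm (FreeAlgebra.ι k i) = ι k A (b.coord i) := fun i => by
    have := TensorAlgebra.equivFreeAlgebra_symm_ι b.dualBasis i
    rw [Module.Basis.coe_dualBasis] at this
    exact this
  let θ : FreeAlgebra k (Fin n) →ₐ[k] FreeAlgebra k (Fin n) :=
    (e.symm.toAlgHom.comp (liftBasis b f)).comp eH.symm.toAlgHom
  have hθ : ∀ x, θ x = e.symm (liftBasis b f (eH.symm x)) := fun _ => rfl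
  have hbij : Function.Bijective θ := by
    refine FreeAlgebra.bijective_of_triangular θ fun i => ?_
    rw [hθ, heH, liftBasis_coord]
    have h := Subalgebra.mem_map.2 ⟨_, hf i, (rfl : e.symm.toAlgHom _ = _)⟩
    rw [AlgHom.map_adjoin, Set.image_image] at h
    simpa using h
  have heq : liftBasis b f = e ∘ θ ∘ eH := by
    ext x
    simp [hθ]
  rw [heq]
  exact e.bijective.comp (hbij.comp eH.bijective)

variable [Bialgebra k U]

/-- Pairing the group-like identity with `φ` in the `A` factor yields the formula for `Δ` on `H_A`,
with `f i` in place of the dual basis vectors; this is the compatibility needed on generators. -/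
theorem comul_of_groupLike {f : Fin n → U}
    (hf : baseComul k A U (1 + ∑ i, (b i : A) ⊗ₜ[k] f i) =
      baseLeft k A U (1 + ∑ i, (b i : A) ⊗ₜ[k] f i) *
      baseRight k A U (1 + ∑ i, (b i : A) ⊗ₜ[k] f i))
    (φ : Module.Dual k (maximalIdeal A)) :
    ∑ i, φ (b i) • comul (R := k) (f i) = (∑ i, ∑ j, φ (b i * b j) • (f i ⊗ₜ[k] f j)) +
      (∑ i, φ (b i) • f i) ⊗ₜ 1 + 1 ⊗ₜ ∑ i, φ (b i) • f i := by
  -- `φ` is defined only on `𝔪`, so a linear retraction `P : A → 𝔪` is used to apply it to the `A`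
  -- factor. Once the summand `1` is cancelled, all first factors lie in `𝔪`, and the choice of `P`
  -- plays no role.
  obtain ⟨P, hP⟩ := LinearMap.exists_leftInverse_of_injective
    ((maximalIdeal A).subtype.restrictScalars k) (LinearMap.ker_eq_bot.2 Subtype.val_injective)
  have hP' : ∀ x : maximalIdeal A, P x = x := fun x => LinearMap.congr_fun hP x
  have hPm : ∀ x y : maximalIdeal A, P ((x : A) * y) = x * y := fun x y => hP' (x * y)
  simp only [baseComul, baseLeft, baseRight, map_add, map_one, map_sum,
    Algebra.TensorProduct.map_tmul, AlgHom.id_apply, comulAlgHom_apply, mul_add, add_mul, one_mul,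
    mul_one, add_assoc, add_right_inj, Finset.sum_mul_sum, Algebra.TensorProduct.tmul_mul_tmul,
    Algebra.TensorProduct.includeLeft_apply, Algebra.TensorProduct.includeRight_apply] at hf
  have h := congrArg (TensorProduct.lid k _ ∘ (φ ∘ₗ P).rTensor (U ⊗[k] U)) hf
  simp only [Function.comp_apply, map_add, map_sum, LinearMap.rTensor_tmul,
    TensorProduct.lid_tmul, LinearMap.comp_apply, hP', hPm] at h
  rw [h, TensorProduct.sum_tmul, TensorProduct.tmul_sum]
  simp only [TensorProduct.tmul_smul, ← TensorProduct.smul_tmul']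
  abel

/-- Under `id ⊗ ε` each exponential becomes the exponential of `0`, so `∑ ε(f i) • b i = 0`, and the
basis is linearly independent. -/
theorem counit_of_prod_truncExp {p : ℕ} (hp : 2 ≤ p) {u f : Fin n → U}
    (hu : ∀ i, counit (R := k) (u i) = 0)
    (h : ((List.finRange n).map fun i => truncExp k p ((b i : A) ⊗ₜ[k] u i)).prod =
      1 + ∑ i, (b i : A) ⊗ₜ[k] f i) (i : Fin n) : counit (R := k) (f i) = 0 := by
  have h1 := congrArg (Algebra.TensorProduct.map (AlgHom.id k A) (counitAlgHom k U)) h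
  rw [map_list_prod, List.map_map, List.prod_eq_one, map_add, map_one, left_eq_add] at h1
  · have h2 := congrArg (TensorProduct.rid k A) h1
    simp only [map_sum, Algebra.TensorProduct.map_tmul, AlgHom.id_apply, counitAlgHom_apply,
      TensorProduct.rid_tmul, map_zero] at h2
    refine Fintype.linearIndependent_iff.1 b.linearIndependent (fun i => counit (f i)) ?_ i
    refine Subtype.ext ?_
    simpa using h2
  · simp [map_truncExp, hu, truncExp_zero k (show 0 < p by omega)]

/-- If all `p`-th powers of elements of `𝔪` vanish and `U` is freely generated as an algebra by
`dim 𝔪` primitive elements, then `H_A` is isomorphic to `U`. -/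
theorem nonempty_equiv_of_pow_eq_zero [Module.Finite k A] (p : ℕ) [Fact p.Prime] [CharP k p]
    (hA : ∀ a ∈ maximalIdeal A, a ^ p = 0)
    (e : FreeAlgebra k (Fin (Module.finrank k (maximalIdeal A))) ≃ₐ[k] U)
    (he : ∀ i, comul (R := k) (e (FreeAlgebra.ι k i)) =
      e (FreeAlgebra.ι k i) ⊗ₜ 1 + 1 ⊗ₜ e (FreeAlgebra.ι k i)) :
    Nonempty (LocalHopf k A ≃ₐc[k] U) := by
  obtain ⟨b, hb⟩ := exists_triangular_basis k A
  have hp : 2 ≤ p := (Fact.out : p.Prime).two_le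
  have hb0 : ∀ i, ((b i : maximalIdeal A) : A) ^ p = 0 := fun i => hA _ (b i).2
  obtain ⟨f, hf, hprod⟩ := exists_prod_truncExp_eq hb (fun i => e (FreeAlgebra.ι k i)) hp
  have hgl := baseComul_prod_truncExp (factorial_cast_ne_zero k p) hb0 he (List.finRange _)
  -- The product of exponentials is now seen through its coordinates `f`, so its group-likeness
  -- becomes a statement about the `f i`.
  rw [hprod] at hgl
  have hcomul := comul_of_groupLike b hgl
  have hcounit := counit_of_prod_truncExp b hp (fun i => counit_eq_zero_of_comul_eq (he i)) hprod
  refine ⟨.ofBijective (.ofAlgHom (liftBasis b f) (algHom_ext k A fun φ => ?_)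
    (algHom_ext k A fun φ => ?_)) (bijective_liftBasis b e hf)⟩
  · rw [AlgHom.comp_apply, liftBasis_ι]
    refine Eq.trans ?_ (counitHom_ι k A φ).symm
    simp [hcounit]
  · have h1 : comulAlgHom k (LocalHopf k A) (ι k A φ) = _ := comulHom_ι k A b φ
    rw [AlgHom.comp_apply, AlgHom.comp_apply, h1, liftBasis_ι]
    simp only [map_add, map_sum, map_smul, Algebra.TensorProduct.map_tmul, liftBasis_coord,
      liftBasis_ι b f φ, map_one, comulAlgHom_apply, hcomul φ]

end LocalHopf

end LocalHopfEquiv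

/-! ### The universal enveloping algebra of a free Lie algebra -/

section FreeLie

variable (k X : Type*) [Field k]

/-- The generators of the universal enveloping algebra of a free Lie algebra. -/
noncomputable def FreeLieAlgebra.envGen (x : X) :
    UniversalEnvelopingAlgebra k (FreeLieAlgebra k X) :=
  (universalEnvelopingEquivFreeAlgebra k X).symm (FreeAlgebra.ι k x)

theorem FreeLieAlgebra.comul_envGen (x : X) :
    comul (R := k) (envGen k X x) = envGen k X x ⊗ₜ 1 + 1 ⊗ₜ envGen k X x := by
  have h : envGen k X x = UniversalEnvelopingAlgebra.ι k (of k x) := by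
    rw [envGen, universalEnvelopingEquivFreeAlgebra_symm_apply, FreeAlgebra.lift_ι_apply]
    rfl
  rw [h]
  exact UniversalEnvelopingAlgebra.comulHom_ι k _ _

end FreeLie

/-! ### Hopf algebras freely generated by primitive elements -/

section Coproduct

open CategoryTheory Limits

variable {k : Type u} [Field k]

/-- `x : σ → H` is a family of free algebra generators of `H` which are primitive. -/
structure IsFreePrimitive (k : Type*) {σ H : Type*} [Field k] [Ring H] [Bialgebra k H]
    (x : σ → H) : Prop where
  bijective : Function.Bijective (FreeAlgebra.lift k x)
  comul : ∀ i, comul (R := k) (x i) = x i ⊗ₜ 1 + 1 ⊗ₜ x i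

namespace IsFreePrimitive

variable {σ H H' : Type*} [Ring H] [Bialgebra k H] [Ring H'] [Bialgebra k H'] {x : σ → H}

theorem adjoin_eq_top (hx : IsFreePrimitive k x) : Algebra.adjoin k (Set.range x) = ⊤ := by
  rw [Algebra.adjoin_range_eq_range_freeAlgebra_lift]
  exact (AlgHom.range_eq_top _).2 hx.bijective.2

theorem bialgHom_ext (hx : IsFreePrimitive k x) {f g : H →ₐc[k] H'} (h : ∀ i, f (x i) = g (x i)) :
    f = g := by
  have h1 : (f : H →ₐ[k] H') = g := AlgHom.ext_of_adjoin_eq_top hx.adjoin_eq_top (by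
    rintro _ ⟨i, rfl⟩
    exact h i)
  exact BialgHom.ext fun y => DFunLike.congr_fun h1 y

/-- With `bialgHom_ext`, this is the universal property behind the coproduct: bialgebra maps out of
`H` are families of primitive elements indexed by `σ`. -/
theorem exists_bialgHom (hx : IsFreePrimitive k x) {y : σ → H'}
    (hy : ∀ i, Coalgebra.comul (R := k) (y i) = y i ⊗ₜ 1 + 1 ⊗ₜ y i) :
    ∃ f : H →ₐc[k] H', ∀ i, f (x i) = y i := by
  let e : FreeAlgebra k σ ≃ₐ[k] H := AlgEquiv.ofBijective _ hx.bijective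
  let f : H →ₐ[k] H' := (FreeAlgebra.lift k y).comp e.symm.toAlgHom
  have hf : ∀ i, f (x i) = y i := fun i => by
    have h1 : e (FreeAlgebra.ι k i) = x i := FreeAlgebra.lift_ι_apply _ _
    have h2 : f (x i) = FreeAlgebra.lift k y (e.symm (x i)) := rfl
    rw [h2, ← h1, e.symm_apply_apply, FreeAlgebra.lift_ι_apply]
  refine ⟨BialgHom.ofPrimitive f (Set.range x) hx.adjoin_eq_top ?_ ?_, hf⟩
  · rintro _ ⟨i, rfl⟩
    exact hx.comul i
  · rintro _ ⟨i, rfl⟩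
    rw [hf]
    exact hy i

theorem map_equiv (hx : IsFreePrimitive k x) (e : H ≃ₐc[k] H') :
    IsFreePrimitive k fun i => e (x i) where
  bijective := by
    have h : FreeAlgebra.lift k (fun i => e (x i)) =
        ((e : H ≃ₐ[k] H') : H →ₐ[k] H').comp (FreeAlgebra.lift k x) := by
      ext i
      simp
    rw [h]
    exact e.bijective.comp hx.bijective
  comul i := BialgHom.comul_apply_of_primitive (e : H →ₐc[k] H') (hx.comul i)

end IsFreePrimitive

/-- A Hopf algebra freely generated by a family of primitive elements is the coproduct of copies of
a Hopf algebra freely generated by one primitive element. -/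
theorem exists_isColimit_cofan {σ : Type*} {W H : HopfAlgCat.{u} k} {w : W}
    (hw : IsFreePrimitive k fun _ : Unit => w) {x : σ → H} (hx : IsFreePrimitive k x) :
    ∃ inj : ∀ _ : σ, W ⟶ H, Nonempty (IsColimit (Cofan.mk H inj)) := by
  -- The `i`-th injection sends `w` to `x i`; the map to another cofan then has to send `x i` to the
  -- image of `w` under the `i`-th leg, again a primitive element.
  choose inj hinj using fun i => hw.exists_bialgHom (y := fun _ => x i) fun _ => hx.comul i
  have hd : ∀ t : Cofan fun _ : σ => W, ∃ f : H →ₐc[k] t.pt, ∀ i,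
      f (x i) = (t.inj i).toBialgHom w := fun t =>
    hx.exists_bialgHom fun i => BialgHom.comul_apply_of_primitive _ (hw.comul ())
  choose desc hdesc using hd
  refine ⟨fun i => ConcreteCategory.ofHom (inj i), ⟨Cofan.IsColimit.mk _
    (fun t => ConcreteCategory.ofHom (desc t)) (fun t i => ?_) fun t m hm => ?_⟩⟩
  · refine HopfAlgCat.hom_ext _ _ (hw.bialgHom_ext fun _ => ?_)
    exact (congrArg (desc t) (hinj i ())).trans (hdesc t i)
  · refine HopfAlgCat.hom_ext _ _ (hx.bialgHom_ext fun i => ?_)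
    have h1 := congrArg (fun f => HopfAlgCat.Hom.toBialgHom f w) (hm i)
    refine Eq.trans ?_ (h1.trans (hdesc t i).symm)
    exact congrArg m.toBialgHom (hinj i ()).symm

end Coproduct

theorem FreeLieAlgebra.isFreePrimitive_envGen (k X : Type*) [Field k] :
    IsFreePrimitive k (envGen k X) where
  bijective := by
    have h : FreeAlgebra.lift k (envGen k X) =
        ((universalEnvelopingEquivFreeAlgebra k X).symm : FreeAlgebra k X →ₐ[k] _) := by
      ext i
      simp [envGen]
    rw [h]
    exact (universalEnvelopingEquivFreeAlgebra k X).symm.bijective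
  comul := comul_envGen k X

/-! ### The non-commutative Witt Hopf algebra of length one -/

section Witt

variable {k : Type u} [Field k] {p : ℕ} {L : ℕ∞} {E : ℕ → NSymm k}

theorem IsCurve.comul_apply_one {H : Type*} [Ring H] [HopfAlgebra k H] {c : ℕ → H} (hc : IsCurve k L c)
    (hL : ((1 : ℕ) : ℕ∞) ≤ L) : Coalgebra.comul (R := k) (c 1) = c 1 ⊗ₜ 1 + 1 ⊗ₜ c 1 := by
  rw [hc.comul 1 le_rfl hL, Finset.Nat.antidiagonal_succ]
  simp [hc.zero, add_comm]

/-- No variable has index in the empty interval `Set.Ico 1 1`, so `E 1` and `Z 1` differ by a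
scalar. Both have counit zero, hence so does the scalar. -/
theorem IsHomogeneousMinimalCurve.apply_one (hE : IsHomogeneousMinimalCurve k p L E)
    (hL : ((p ^ 0 : ℕ) : ℕ∞) ≤ L) : E 1 = NSymm.Z k 1 := by
  have h := hE.leading 0 hL
  rw [pow_zero, Set.Ico_self, Set.image_empty, Algebra.adjoin_empty] at h
  obtain ⟨c, hc⟩ := Algebra.mem_bot.1 h
  have h1 : counit (R := k) (E 1) = 0 :=
    counit_eq_zero_of_comul_eq (hE.toIsCurve.comul_apply_one (by simpa using hL))
  have h2 : counit (R := k) (NSymm.Z k 1) = 0 := NSymm.counitHom_Z k 1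
  have h3 := congrArg (counit (R := k)) hc
  rw [map_sub, h1, h2, Bialgebra.counit_algebraMap, sub_zero] at h3
  rw [h3, map_zero] at hc
  exact (sub_eq_zero.1 hc.symm)

variable [Fact p.Prime]

theorem ncWitt.comul_gen (hE : IsHomogeneousMinimalCurve k p L E)
    (hL : ((p ^ 0 : ℕ) : ℕ∞) ≤ L) :
    comul (R := k) (ncWitt.gen hE hL 0 le_rfl) =
      ncWitt.gen hE hL 0 le_rfl ⊗ₜ[k] 1 + 1 ⊗ₜ[k] ncWitt.gen hE hL 0 le_rfl := by
  -- The tensor square of the subalgebra embeds in that of `NSymm k`, where the curve condition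
  -- gives the formula.
  apply (ncWittSubalgebra p E 0).map_val_injective
  refine ((hE.isHopf_ncWittSubalgebra hL).map_comulHom _).trans ?_
  have h := hE.toIsCurve.comul_apply_one (k := k) (by simpa using hL)
  rw [← pow_zero p] at h
  refine h.trans ?_
  symm
  refine (map_add _ _ _).trans ?_
  erw [Algebra.TensorProduct.map_tmul, Algebra.TensorProduct.map_tmul]
  rfl

theorem ncWitt.exists_algEquiv (hE : IsHomogeneousMinimalCurve k p L E)
    (hL : ((p ^ 0 : ℕ) : ℕ∞) ≤ L) :
    ∃ e : ncWitt hE hL ≃ₐ[k] Polynomial k, e (ncWitt.gen hE hL 0 le_rfl) = Polynomial.X := by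
  let W := ncWittSubalgebra p E 0
  let g : W := ⟨E (p ^ 0), Algebra.subset_adjoin ⟨0, le_rfl, rfl⟩⟩
  have hg : (g : NSymm k) = NSymm.Z k 1 :=
    (congrArg E (pow_zero p)).trans (hE.apply_one hL)
  let F : Polynomial k →ₐ[k] W := Polynomial.aeval g
  -- A left inverse of `F`, showing that `E₁` satisfies no polynomial relation. Only the value at
  -- `Z₁` matters; the other variables could go anywhere.
  let G : W →ₐ[k] Polynomial k := (NSymm.lift fun _ => Polynomial.X).comp W.val
  have hGg : G g = Polynomial.X := by
    have : G g = NSymm.lift (fun _ => Polynomial.X) (g : NSymm k) := rfl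
    rw [this, hg]
    exact NSymm.lift_Z_succ _ 0
  have hGF : G.comp F = AlgHom.id k _ := Polynomial.algHom_ext (by simp [F, hGg])
  have hsurj : Function.Surjective F := by
    rintro ⟨y, hy⟩
    have hle : W ≤ (W.val.comp F).range := by
      refine Algebra.adjoin_le ?_
      rintro _ ⟨i, hi, rfl⟩
      obtain rfl : i = 0 := by omega
      exact ⟨Polynomial.X, by simp [F, g]⟩
    obtain ⟨q, hq⟩ := hle hy
    exact ⟨q, Subtype.ext hq⟩
  have hinj : Function.Injective F :=
    Function.LeftInverse.injective (g := G) fun q => DFunLike.congr_fun hGF q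
  let e : W ≃ₐ[k] Polynomial k := (AlgEquiv.ofBijective F ⟨hinj, hsurj⟩).symm
  have he : e g = Polynomial.X := by
    rw [AlgEquiv.symm_apply_eq]
    exact (Polynomial.aeval_X g).symm
  exact ⟨e, he⟩

theorem ncWitt.isFreePrimitive (hE : IsHomogeneousMinimalCurve k p L E)
    (hL : ((p ^ 0 : ℕ) : ℕ∞) ≤ L) :
    IsFreePrimitive k fun _ : Unit => ncWitt.gen hE hL 0 le_rfl where
  bijective := by
    obtain ⟨e, he⟩ := ncWitt.exists_algEquiv hE hL
    let q : FreeAlgebra k Unit →ₐ[k] Polynomial k := FreeAlgebra.lift k fun _ => Polynomial.X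
    -- On one generator, the free associative algebra is the polynomial ring.
    have hq : Function.Bijective q := by
      let q' : Polynomial k →ₐ[k] FreeAlgebra k Unit := Polynomial.aeval (FreeAlgebra.ι k ())
      have h1 : q.comp q' = AlgHom.id k _ := Polynomial.algHom_ext (by simp [q, q'])
      have h2 : q'.comp q = AlgHom.id k _ := by
        ext
        simp [q, q']
      exact (AlgEquiv.ofAlgHom q q' h1 h2).bijective
    have h : FreeAlgebra.lift k (fun _ : Unit => ncWitt.gen hE hL 0 le_rfl) =
        (e.symm : Polynomial k →ₐ[k] _).comp q := by
      ext
      simp [q, ← he]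
    rw [h]
    exact e.symm.bijective.comp hq
  comul _ := ncWitt.comul_gen hE hL

end Witt

/-! ### Height one and the main theorem. -/

theorem pow_eq_zero_of_frobeniusHeight_eq_one {p : ℕ} {A : Type*} [CommRing A] [IsLocalRing A]
    (h : frobeniusHeight p A = 1) (a : A) (ha : a ∈ IsLocalRing.maximalIdeal A) : a ^ p = 0 := by
  -- The infimum of the empty set of naturals is `0`, so a height equal to `1` is an attained
  -- minimum.
  have hne : {i : ℕ | ∀ a ∈ IsLocalRing.maximalIdeal A, a ^ p ^ i = 0}.Nonempty := by
    by_contra hne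
    rw [Set.not_nonempty_iff_eq_empty] at hne
    rw [frobeniusHeight, hne, Nat.sInf_empty] at h
    exact zero_ne_one h
  have hmem := Nat.sInf_mem hne
  change sInf {i : ℕ | ∀ a ∈ IsLocalRing.maximalIdeal A, a ^ p ^ i = 0} = 1 at h
  rw [h] at hmem
  simpa using hmem a ha

/-- The bound `hL` is `1 ≤ L`, in the form `p ^ 0` that `ncWitt` takes at `ℓ = 0`. -/
theorem mainTheorem11 {k A : Type u} [Field k] [IsAlgClosed k] (p : ℕ) [Fact p.Prime] [CharP k p]
    [CommRing A] [Algebra k A] [Module.Finite k A] [IsLocalRing A]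
    (h : frobeniusHeight p A = 1) :
    (∀ (L : ℕ∞) (E : ℕ → NSymm k) (hE : IsHomogeneousMinimalCurve k p L E)
      (hL : ((p ^ 0 : ℕ) : ℕ∞) ≤ L),
      -- `H_A` is a coproduct, in the category of Hopf algebras, of `dim 𝔪` copies of `NW₁`
      (∃ inj : ∀ _ : Fin (Module.finrank k (IsLocalRing.maximalIdeal A)),
          ncWitt hE hL ⟶ HopfAlgCat.of k (LocalHopf k A),
        Nonempty (CategoryTheory.Limits.IsColimit (CategoryTheory.Limits.Cofan.mk _ inj))) ∧
      -- `NW₁` is the polynomial algebra `k[E₁]`, with `E₁` primitive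
      (∃ e : ncWitt hE hL ≃ₐ[k] Polynomial k, e (ncWitt.gen hE hL 0 le_rfl) = Polynomial.X) ∧
      (Coalgebra.comul (R := k) (ncWitt.gen hE hL 0 le_rfl) =
        ncWitt.gen hE hL 0 le_rfl ⊗ₜ[k] 1 + 1 ⊗ₜ[k] ncWitt.gen hE hL 0 le_rfl)) ∧
    -- `H_A` is, as a Hopf algebra, the universal enveloping algebra of a free Lie algebra
    Nonempty (LocalHopf k A ≃ₐc[k] UniversalEnvelopingAlgebra k
      (FreeLieAlgebra k (Fin (Module.finrank k (IsLocalRing.maximalIdeal A))))) := by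
  obtain ⟨e⟩ := LocalHopf.nonempty_equiv_of_pow_eq_zero (k := k) (A := A) p
    (pow_eq_zero_of_frobeniusHeight_eq_one h)
    (FreeLieAlgebra.universalEnvelopingEquivFreeAlgebra k _).symm
    (FreeLieAlgebra.comul_envGen k _)
  refine ⟨fun L E hE hL => ⟨?_, ncWitt.exists_algEquiv hE hL, ncWitt.comul_gen hE hL⟩, ⟨e⟩⟩
  -- The free primitive generators of the enveloping algebra are carried to `H_A` by the inverse of
  -- `e`.
  exact exists_isColimit_cofan (ncWitt.isFreePrimitive hE hL)
    ((FreeLieAlgebra.isFreePrimitive_envGen k _).map_equiv e.symm)
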